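/- Let $n\ge 1$ and let $V:\mathbb R^n\to\mathbb R$ be smooth with $V=V_\infty+V_s$, where $V_\infty$ is real-valued and homogeneous of order zero, i.e. $V_\infty(x)=V_\infty(x/|x|)$ for $|x|\ge 1$, and $V_s(x)=o(|x|^{-1})$ as $|x|\to\infty$. Let $P=-\Delta+V$ be the corresponding self-adjoint operator on $L^2(\mathbb R^n)$, and $e^{-itP}$ its unitary group. Put $\ell(0)=\frac23$ and $\ell(k)=\frac1{k+1}$ for integers $k\ge1$. Let $\theta_0\in S^{n-1}$ and let $k\ge 0$ be an integer such that the restriction of $V_\infty$ to $S^{n-1}$ is of class $C^k$ near $\theta_0$ and its derivatives of the orders $1,\dots,k$ vanish at $\theta_0$ (for $k=0$ no derivative is required to vanish). Let $\Omega\subset\mathbb R^n$ be a domain (a nonempty connected open set) such that, for some $R,C>0$, $$\Omega\cap\{x:|x|>R\}\subset\mathbb R^n\setminus\{x=r\theta:\ r>R,\ \theta\in S^{n-1},\ \mathrm{dist}(\theta,\theta_0)<Cr^{-\ell(k)}\},$$ where $\mathrm{dist}$ is the geodesic distance (the angle) on the unit sphere. Then observability on $\Omega$ fails for every time $T>0$: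 there is no constant $C'>0$ such that $$\|u\|_{L^2(\mathbb R^n)}^2\le C'\int_0^T\!\int_\Omega|e^{-itP}u(x)|^2\,dx\,dt\qquad\text{for all }u\in L^2(\mathbb R^n),$$ and, moreover, there is a sequence $u_m\in L^2(\mathbb R^n)$ with $\|u_m\|_{L^2(\mathbb R^n)}=1$ and $$\int_0^T\!\int_\Omega|e^{-itP}u_m(x)|^2\,dx\,dt\to0\qquad(m\to\infty).$$ -/

import Mathlib

open MeasureTheory Filter Topology Set
open scoped ContDiff ENNReal Laplacian

noncomputable section

namespace HomogeneousSchrodinger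

/-- Euclidean space `ℝⁿ`. -/
abbrev Eucl (n : ℕ) : Type := EuclideanSpace ℝ (Fin n)

/-- The Hilbert space `L²(ℝⁿ; ℂ)` with respect to Lebesgue measure. -/
abbrev L2 (n : ℕ) : Type := Lp ℂ 2 (volume : Measure (Eucl n))

/-! ### The unitary group generated by an unbounded operator -/

/-- `U` is a strongly continuous one-parameter unitary group on the Hilbert space `H` whose
infinitesimal generator is exactly `-iA`: the derivative of `t ↦ U(t)u` at `0` exists if and only
if `u` is in the domain of `A`, and it is then `-iAu`. -/
structure IsUnitaryGroupOf {H : Type*} [NormedAddCommGroup H] [InnerProductSpace ℂ H]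
    (A : H →ₗ.[ℂ] H) (U : ℝ → (H ≃ₗᵢ[ℂ] H)) : Prop where
  zero : U 0 = 1
  add : ∀ s t : ℝ, U (s + t) = U s * U t
  strongly_continuous : ∀ u : H, Continuous fun t : ℝ => U t u
  generator : ∀ u w : H,
    HasDerivAt (fun t : ℝ => U t u) w 0 ↔ ∃ hu : u ∈ A.domain, w = -(Complex.I • A ⟨u, hu⟩)

open Classical in
/-- The family `t ↦ e^{-itA}`. For a self-adjoint `A` (the only case of interest) the group in the
condition exists and is unique, by Stone's theorem; the value in the other case is irrelevant. -/
def expNegI {H : Type*} [NormedAddCommGroup H] [InnerProductSpace ℂ H]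
    (A : H →ₗ.[ℂ] H) : ℝ → (H ≃ₗᵢ[ℂ] H) :=
  if h : ∃ U : ℝ → (H ≃ₗᵢ[ℂ] H), IsUnitaryGroupOf A U then h.choose else fun _ => 1

/-! ### The Schrödinger operator -/

/-- `-Δu + Vu = f` in the sense of distributions on `ℝⁿ`. -/
def WeakSchrodinger {n : ℕ} (V : Eucl n → ℝ) (u f : L2 n) : Prop :=
  LocallyIntegrable (fun x => V x • u x) volume ∧
    ∀ φ : Eucl n → ℝ, ContDiff ℝ ∞ φ → HasCompactSupport φ →
      (∫ x, (-(Δ φ) x) • u x) + (∫ x, φ x • (V x • u x)) = ∫ x, φ x • f x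

theorem integrable_test {n : ℕ} {φ : Eucl n → ℝ} (hφ : Continuous φ)
    (hc : HasCompactSupport φ) {g : Eucl n → ℂ} (hg : LocallyIntegrable g volume) :
    Integrable (fun x => φ x • g x) volume :=
  hg.integrable_smul_left_of_hasCompactSupport hφ hc

theorem locInt {n : ℕ} (u : L2 n) : LocallyIntegrable (fun x => u x) volume :=
  (Lp.memLp u).locallyIntegrable (by norm_num)

theorem continuous_laplacian {n : ℕ} {φ : Eucl n → ℝ} (hφ : ContDiff ℝ ∞ φ) :
    Continuous (Δ φ) := by
  rw [InnerProductSpace.laplacian_eq_iteratedFDeriv_stdOrthonormalBasis]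
  refine continuous_finsetSum _ fun i _ => ?_
  have h := (contDiff_infty.mp hφ 2).continuous_iteratedFDeriv (m := 2) (by norm_num)
  fun_prop

theorem compact_laplacian {n : ℕ} {φ : Eucl n → ℝ} (hc : HasCompactSupport φ) :
    HasCompactSupport (Δ φ) := by
  rw [InnerProductSpace.laplacian_eq_iteratedFDeriv_stdOrthonormalBasis]
  refine (hc.iteratedFDeriv (𝕜 := ℝ) 2).mono ?_
  intro x hx h0
  apply hx
  simp [h0]

/-- The graph of the Schrödinger operator: the pairs `(u, f)` in `L² × L²` with `-Δu + Vu = f`. -/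
def schrodingerGraph {n : ℕ} (V : Eucl n → ℝ) : Submodule ℂ (L2 n × L2 n) where
  carrier := {p | WeakSchrodinger V p.1 p.2}
  zero_mem' := by
    have h0 := Lp.coeFn_zero ℂ 2 (volume : Measure (Eucl n))
    refine ⟨(locallyIntegrable_zero (μ := volume)).congr ?_, fun φ _ _ => ?_⟩
    · filter_upwards [h0] with x _
      simp
    · have e : ∀ ψ : Eucl n → ℝ, ∫ x, ψ x • (0 : L2 n) x = 0 := fun ψ => by
        refine integral_eq_zero_of_ae ?_
        filter_upwards [h0] with x _
        simp
      have e' : ∫ x, φ x • (V x • (0 : L2 n) x) = 0 := by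
        simpa only [smul_smul] using e fun x => φ x * V x
      simp only [Prod.fst_zero, Prod.snd_zero]
      rw [e, e, e', add_zero]
  add_mem' := by
    rintro ⟨u, f⟩ ⟨v, g⟩ ⟨hu, hu'⟩ ⟨hv, hv'⟩
    have huv := Lp.coeFn_add u v
    have hfg := Lp.coeFn_add f g
    refine ⟨(hu.add hv).congr ?_, fun φ h1 h2 => ?_⟩
    · filter_upwards [huv] with x hx
      change _ = V x • (u + v) x
      rw [hx]
      simp
    · have hL1 : Continuous fun x => -(Δ φ) x := (continuous_laplacian h1).neg
      have hL2 : HasCompactSupport fun x => -(Δ φ) x := (compact_laplacian h2).neg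
      have e1 : ∫ x, (-(Δ φ) x) • (u + v) x
          = (∫ x, (-(Δ φ) x) • u x) + ∫ x, (-(Δ φ) x) • v x := by
        rw [← integral_add (integrable_test hL1 hL2 (locInt u))
          (integrable_test hL1 hL2 (locInt v))]
        refine integral_congr_ae ?_
        filter_upwards [huv] with x hx
        rw [hx, Pi.add_apply, smul_add]
      have e2 : ∫ x, φ x • (V x • (u + v) x)
          = (∫ x, φ x • (V x • u x)) + ∫ x, φ x • (V x • v x) := by
        rw [← integral_add (integrable_test h1.continuous h2 hu)
          (integrable_test h1.continuous h2 hv)]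
        refine integral_congr_ae ?_
        filter_upwards [huv] with x hx
        rw [hx, Pi.add_apply, smul_add, smul_add]
      have e3 : ∫ x, φ x • (f + g) x = (∫ x, φ x • f x) + ∫ x, φ x • g x := by
        rw [← integral_add (integrable_test h1.continuous h2 (locInt f))
          (integrable_test h1.continuous h2 (locInt g))]
        refine integral_congr_ae ?_
        filter_upwards [hfg] with x hx
        rw [hx, Pi.add_apply, smul_add]
      have a := hu' φ h1 h2
      have b := hv' φ h1 h2
      simp only at a b
      simp only [Prod.mk_add_mk]
      rw [e1, e2, e3, ← a, ← b]
      ring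
  smul_mem' := by
    rintro c ⟨u, f⟩ ⟨hu, hu'⟩
    have hcu := Lp.coeFn_smul c u
    have hcf := Lp.coeFn_smul c f
    refine ⟨(hu.smul c).congr ?_, fun φ h1 h2 => ?_⟩
    · filter_upwards [hcu] with x hx
      simp [hx]
      ring
    · have e : ∀ ψ : Eucl n → ℝ, ∫ x, ψ x • (c • u) x = c • ∫ x, ψ x • u x := fun ψ => by
        rw [← integral_smul]
        refine integral_congr_ae ?_
        filter_upwards [hcu] with x hx
        rw [hx, Pi.smul_apply, smul_comm]
      have e' : ∫ x, φ x • (V x • (c • u) x) = c • ∫ x, φ x • (V x • u x) := by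
        simpa only [smul_smul] using e fun x => φ x * V x
      have e3 : ∫ x, φ x • (c • f) x = c • ∫ x, φ x • f x := by
        rw [← integral_smul]
        refine integral_congr_ae ?_
        filter_upwards [hcf] with x hx
        rw [hx, Pi.smul_apply, smul_comm]
      have a := hu' φ h1 h2
      simp only at a
      simp only [Prod.smul_mk]
      rw [e, e', e3, ← a, smul_add]

/-- `P = -Δ + V` as an unbounded operator on `L²(ℝⁿ)`: its domain consists of the `u ∈ L²` for
which the distribution `-Δu + Vu` is in `L²`, and `Pu` is that function. For bounded `V` the domain
is the Sobolev space `H²(ℝⁿ)` and `P` is self-adjoint. -/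
def schrodingerOp {n : ℕ} (V : Eucl n → ℝ) : L2 n →ₗ.[ℂ] L2 n :=
  (schrodingerGraph V).toLinearPMap

theorem mem_graph_schrodingerOp {n : ℕ} (V : Eucl n → ℝ) (u f : L2 n) :
    (u, f) ∈ (schrodingerOp V).graph ↔ WeakSchrodinger V u f := by
  unfold schrodingerOp
  rw [Submodule.toLinearPMap_graph_eq]
  · rfl
  · rintro ⟨u, f⟩ ⟨-, h⟩ (rfl : u = 0)
    have h0 := Lp.coeFn_zero ℂ 2 (volume : Measure (Eucl n))
    have key := ae_eq_zero_of_integral_contDiff_smul_eq_zero (locInt f) fun φ h1 h2 => by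
      have a := h φ h1 h2
      have e : ∀ ψ : Eucl n → ℝ, ∫ x, ψ x • (0 : L2 n) x = 0 := fun ψ => by
        refine integral_eq_zero_of_ae ?_
        filter_upwards [h0] with x _
        simp
      have e' : ∫ x, φ x • (V x • (0 : L2 n) x) = 0 := by
        simpa only [smul_smul] using e fun x => φ x * V x
      rw [← a]
      simp only
      rw [e, e', add_zero]
    refine Lp.ext ?_
    filter_upwards [key, h0] with x hx hx0
    rw [hx0]
    exact hx

/-! ### The potential -/

/-- `V` is real valued and smooth, and `V = V∞ + Vs`, where `V∞` is homogeneous of order zero in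
`|x| ≥ 1` and `Vs(x) = o(|x|⁻¹)` as `|x| → ∞`. -/
structure IsAsympHomogeneous {n : ℕ} (V Vinf Vs : Eucl n → ℝ) : Prop where
  smooth : ContDiff ℝ ∞ V
  decomp : ∀ x, V x = Vinf x + Vs x
  homogeneous : ∀ x, 1 ≤ ‖x‖ → Vinf x = Vinf (‖x‖⁻¹ • x)
  decay : Vs =o[Bornology.cobounded (Eucl n)] fun x => ‖x‖⁻¹

/-- The derivatives `∂_θ^j V∞(θ₀)`, `1 ≤ j ≤ k`, of the restriction of `V∞` to the unit sphere exist
and vanish. The restriction is differentiated through its extension `x ↦ V∞(x/|x|)`, which is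
constant along rays; so its derivatives of the orders `1, …, k` at `θ₀` vanish if and only if those
of the restriction do, in any local coordinates of the sphere. -/
def AngularDerivVanish {n : ℕ} (Vinf : Eucl n → ℝ) (θ₀ : Eucl n) (k : ℕ) : Prop :=
  ContDiffAt ℝ k (fun x => Vinf (‖x‖⁻¹ • x)) θ₀ ∧
    ∀ j : ℕ, 1 ≤ j → j ≤ k → iteratedFDeriv ℝ j (fun x => Vinf (‖x‖⁻¹ • x)) θ₀ = 0

/-! ### The cone and observability -/

/-- The exponent `ℓ(k)`: `ℓ(0) = 2/3` and `ℓ(k) = 1/(k+1)` for `k > 0`. -/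
def coneExponent (k : ℕ) : ℝ := if k = 0 then 2 / 3 else 1 / ((k : ℝ) + 1)

/-- The shrinking cone `{(r,θ) : r > R, dist(θ,θ₀) < C r^{-ℓ}}` around the direction `θ₀`. The
geodesic distance on the unit sphere of `x/|x|` and `θ₀` is the angle between `x` and `θ₀`. -/
def shrinkingCone {n : ℕ} (θ₀ : Eucl n) (R C l : ℝ) : Set (Eucl n) :=
  {x | R < ‖x‖ ∧ InnerProductGeometry.angle x θ₀ < C * ‖x‖ ^ (-l)}

/-- `∫₀ᵀ ∫_Ω |e^{-itP} u(x)|² dx dt`, where `P = -Δ + V`. -/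
def observedMass {n : ℕ} (V : Eucl n → ℝ) (Ω : Set (Eucl n)) (T : ℝ) (u : L2 n) : ℝ≥0∞ :=
  ∫⁻ t in Ioc 0 T, ∫⁻ x in Ω, ‖expNegI (schrodingerOp V) t u x‖ₑ ^ 2

/-- Observability on `Ω` in time `T`: for some `C > 0`, all `u ∈ L²` satisfy
`‖u‖² ≤ C ∫₀ᵀ ∫_Ω |e^{-itP} u(x)|² dx dt`. -/
def Observable {n : ℕ} (V : Eucl n → ℝ) (Ω : Set (Eucl n)) (T : ℝ) : Prop :=
  ∃ C : ℝ, 0 < C ∧ ∀ u : L2 n, ‖u‖ₑ ^ 2 ≤ ENNReal.ofReal C * observedMass V Ω T u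

end HomogeneousSchrodinger

end

open MeasureTheory Filter Topology Set
open scoped ContDiff ENNReal Laplacian

noncomputable section

/-! The failure of observability comes from quasimodes far out in the direction `θ₀`. At distance
`r` the shrinking cone has width of order `r * r ^ (-l)` with `l < 1`, which tends to infinity, so a
ball of any fixed radius `ρ` centred at `r • θ₀` lies inside it once `r` is large. On such a ball
the direction `x/|x|` is close to `θ₀` and `Vs` is small, so `V` is nearly the constant `Vinf θ₀`. A
normalized bump `u` on the ball has Laplacian of norm `O(ρ⁻²)`. With `ρ` large first and `r` large
afterwards, `‖(P - Vinf θ₀)u‖ ≤ ε`.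

By Duhamel's argument (`IsUnitaryGroupOf.norm_sub_exp_smul_le`) the evolution of `u` up to time `T`
stays within `T * ε` of a unimodular multiple of `u`. As `u` vanishes on `Ω`, only this error is
observed, and the observed mass is at most `(T * ε) ^ 2 * T`. Letting `ε` tend to zero gives the
sequence, and the sequence contradicts any observability constant.

The geometry is in `IsAsympHomogeneous.exists_ball_subset_cone`, the bumps in
`exists_normalized_bump`. The remaining work shows that `-Δ + V`, defined through distributions,
generates a unitary group: the Fourier transform turns `-Δ` into a multiplication operator, and the
bounded potential is added by a Dyson series in the interaction picture
(`IsUnitaryGroupOf.exists_perturbation`). -/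

namespace HomogeneousSchrodinger

/-! ### Unitary groups, their generators and quasimodes. -/

section Abstract

variable {H : Type*} [NormedAddCommGroup H] [InnerProductSpace ℂ H]

/-- A strongly continuous family of linear isometries with the group property is a one-parameter
unitary group. -/
theorem exists_linearIsometryEquiv_of_group (S : ℝ → H →ₗᵢ[ℂ] H) (h0 : ∀ u, S 0 u = u)
    (hadd : ∀ s t u, S (s + t) u = S s (S t u)) :
    ∃ U : ℝ → (H ≃ₗᵢ[ℂ] H), ∀ t u, U t u = S t u := by
  refine ⟨fun t => LinearIsometryEquiv.mk (LinearEquiv.ofLinearMap (S t).toLinearMap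
    (S (-t)).toLinearMap ?_ ?_) fun u => (S t).norm_map u, fun t u => rfl⟩
  · ext u
    simp [← hadd, h0]
  · ext u
    simp [← hadd, h0]

/-- Existence of a unitary group with a prescribed generator, from a group of isometries. -/
theorem exists_isUnitaryGroupOf (A : H →ₗ.[ℂ] H) (S : ℝ → H →ₗᵢ[ℂ] H) (h0 : ∀ u, S 0 u = u)
    (hadd : ∀ s t u, S (s + t) u = S s (S t u)) (hc : ∀ u, Continuous fun t => S t u)
    (hgen : ∀ u w, HasDerivAt (fun t => S t u) w 0 ↔ (u, Complex.I • w) ∈ A.graph) :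
    ∃ U : ℝ → (H ≃ₗᵢ[ℂ] H), IsUnitaryGroupOf A U := by
  obtain ⟨U, hU⟩ := exists_linearIsometryEquiv_of_group S h0 hadd
  refine ⟨U, ⟨?_, ?_, ?_, ?_⟩⟩
  · ext u
    simp [hU, h0]
  · intro s t
    ext u
    change U (s + t) u = U s (U t u)
    simp [hU, hadd]
  · intro u
    simpa only [hU] using hc u
  · intro u w
    simp only [hU]
    rw [hgen, LinearPMap.mem_graph_iff]
    constructor
    · rintro ⟨y, hy, hy'⟩
      subst hy
      refine ⟨y.2, ?_⟩
      rw [Subtype.coe_eta, hy', smul_smul, Complex.I_mul_I, neg_one_smul, neg_neg]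
    · rintro ⟨hu, hw⟩
      refine ⟨⟨u, hu⟩, rfl, ?_⟩
      rw [hw, smul_neg, smul_smul, Complex.I_mul_I, neg_one_smul, neg_neg]

theorem IsUnitaryGroupOf.add_apply {A : H →ₗ.[ℂ] H} {U : ℝ → (H ≃ₗᵢ[ℂ] H)}
    (h : IsUnitaryGroupOf A U) (s t : ℝ) (u : H) : U (s + t) u = U s (U t u) := by
  rw [h.add]
  rfl

theorem IsUnitaryGroupOf.zero_apply {A : H →ₗ.[ℂ] H} {U : ℝ → (H ≃ₗᵢ[ℂ] H)}
    (h : IsUnitaryGroupOf A U) (u : H) : U 0 u = u := by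
  rw [h.zero]
  rfl

theorem IsUnitaryGroupOf.hasDerivAt_iff {A : H →ₗ.[ℂ] H} {U : ℝ → (H ≃ₗᵢ[ℂ] H)}
    (h : IsUnitaryGroupOf A U) (u w : H) :
    HasDerivAt (fun t => U t u) w 0 ↔ (u, Complex.I • w) ∈ A.graph := by
  rw [h.generator, LinearPMap.mem_graph_iff]
  constructor
  · rintro ⟨hu, hw⟩
    refine ⟨⟨u, hu⟩, rfl, ?_⟩
    rw [hw, smul_neg, smul_smul, Complex.I_mul_I, neg_one_smul, neg_neg]
  · rintro ⟨y, hy, hy'⟩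
    subst hy
    refine ⟨y.2, ?_⟩
    rw [Subtype.coe_eta, hy', smul_smul, Complex.I_mul_I, neg_one_smul, neg_neg]

/-- A quasimode `u` evolves like an eigenvector, up to the defect `‖(A - c)u‖`. -/
theorem IsUnitaryGroupOf.norm_sub_exp_smul_le {A : H →ₗ.[ℂ] H} {U : ℝ → (H ≃ₗᵢ[ℂ] H)}
    (h : IsUnitaryGroupOf A U) {u f : H} (huf : (u, f) ∈ A.graph) (c t : ℝ) (ht : 0 ≤ t) :
    ‖U t u - Complex.exp (-(Complex.I * (c * t))) • u‖ ≤ t * ‖f - (c : ℂ) • u‖ := by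
  have hd0 : HasDerivAt (fun t => U t u) (-(Complex.I • f)) 0 := by
    rw [h.hasDerivAt_iff, smul_neg, smul_smul, Complex.I_mul_I, neg_one_smul, neg_neg]
    exact huf
  -- The group law `U t = U s * U (t - s)` carries the derivative at `0` to every time `s`.
  have hd : ∀ s : ℝ, HasDerivAt (fun t => U t u) (U s (-(Complex.I • f))) s := by
    intro s
    have h1 : HasDerivAt (fun t : ℝ => U (t - s) u) (-(Complex.I • f)) s := by
      have : HasDerivAt (fun t => U t u) (-(Complex.I • f)) (s - s) := by rwa [sub_self]
      exact this.comp_sub_const s s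
    have h2 := ((U s).toContinuousLinearEquiv.toContinuousLinearMap.restrictScalars
      ℝ).hasFDerivAt.comp_hasDerivAt s h1
    refine (h2.congr_of_eventuallyEq (Eventually.of_forall fun t => ?_))
    have := h.add_apply s (t - s) u
    simp only [add_sub_cancel] at this
    exact this
  have he : ∀ s : ℝ, HasDerivAt (fun s : ℝ => Complex.exp (Complex.I * (c * s)))
      (Complex.exp (Complex.I * (c * s)) * (Complex.I * c)) s := by
    intro s
    have : HasDerivAt (fun s : ℝ => Complex.I * (c * (s : ℂ))) (Complex.I * (c * 1)) s :=
      ((Complex.ofRealCLM.hasDerivAt (x := s)).const_mul (c : ℂ)).const_mul Complex.I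
    simpa using this.cexp
  have hn : ∀ s : ℝ, ‖Complex.exp (Complex.I * (c * s))‖ = 1 := by
    intro s
    rw [mul_comm, ← Complex.ofReal_mul]
    exact Complex.norm_exp_ofReal_mul_I _
  -- Undoing the phase leaves a curve whose speed is exactly the defect `‖f - c • u‖`, since the
  -- phase and `U s` are isometric; the mean value inequality then gives linear growth.
  have hg : ∀ s : ℝ, HasDerivAt (fun s : ℝ => Complex.exp (Complex.I * (c * s)) • U s u)
      (Complex.exp (Complex.I * (c * s)) • U s (-(Complex.I • (f - (c : ℂ) • u)))) s := by
    intro s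
    refine ((he s).smul (hd s)).congr_deriv ?_
    simp only [map_neg, map_sub, map_smul, smul_sub, smul_neg, smul_smul]
    module
  have hb := norm_image_sub_le_of_norm_deriv_le_segment' (a := 0) (b := t)
    (C := ‖f - (c : ℂ) • u‖) (fun s _ => (hg s).hasDerivWithinAt)
    (fun s _ => by rw [norm_smul, hn, one_mul, LinearIsometryEquiv.norm_map, norm_neg, norm_smul,
      Complex.norm_I, one_mul]) t (right_mem_Icc.2 ht)
  have hmul : Complex.exp (Complex.I * (c * t)) • (U t u - Complex.exp (-(Complex.I * (c * t))) • u)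
      = Complex.exp (Complex.I * (c * t)) • U t u
        - Complex.exp (Complex.I * (c * (0 : ℝ))) • U 0 u := by
    rw [smul_sub, smul_smul, ← Complex.exp_add, h.zero_apply]
    simp
  rw [← hmul, norm_smul, hn, one_mul, sub_zero] at hb
  linarith

end Abstract

/-! ### Dyson series and bounded perturbations of a generator. -/

section LinearODE

variable {H : Type*} [NormedAddCommGroup H] [InnerProductSpace ℂ H]

/-- A strongly continuous, uniformly bounded family of operators is jointly continuous. -/
theorem continuous_clm_apply_of_strong {X : Type*} [TopologicalSpace X] {F : X → H →L[ℂ] H} {M : ℝ}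
    (hF : ∀ x, Continuous fun t => F t x) (hM : ∀ t, ‖F t‖ ≤ M) {y : X → H} (hy : Continuous y) :
    Continuous fun t => F t (y t) := by
  rw [continuous_iff_continuousAt]
  intro s
  have h1 : Tendsto (fun t => F t (y t - y s)) (𝓝 s) (𝓝 0) := by
    have h2 : Tendsto (fun t => M * ‖y t - y s‖) (𝓝 s) (𝓝 0) := by
      have h3 : ContinuousAt (fun t => M * ‖y t - y s‖) s := by fun_prop
      simpa [ContinuousAt] using h3
    refine squeeze_zero_norm (fun t => ?_) h2
    exact (F t).le_of_opNorm_le (hM t) _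
  have h4 := h1.add ((hF (y s)).tendsto s)
  simp only [zero_add] at h4
  refine h4.congr fun t => ?_
  rw [map_sub, sub_add_cancel]

/-- The terms of the Dyson series of `y' = F(t) y`, `y(0) = u`. -/
def dysonTerm (F : ℝ → H →L[ℂ] H) (u : H) : ℕ → ℝ → H
  | 0 => fun _ => u
  | n + 1 => fun t => ∫ s in (0 : ℝ)..t, F s (dysonTerm F u n s)

variable {F : ℝ → H →L[ℂ] H} {M : ℝ}

theorem hasDerivAt_dysonTerm_succ [CompleteSpace H] (n : ℕ) (u : H)
    (hc : Continuous fun s => F s (dysonTerm F u n s)) (t : ℝ) :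
    HasDerivAt (dysonTerm F u (n + 1)) (F t (dysonTerm F u n t)) t :=
  intervalIntegral.integral_hasDerivAt_right (hc.intervalIntegrable _ _)
    (hc.stronglyMeasurableAtFilter _ _) hc.continuousAt

theorem continuous_dysonTerm [CompleteSpace H] (hF : ∀ x, Continuous fun t => F t x)
    (hM : ∀ t, ‖F t‖ ≤ M) (u : H) (n : ℕ) : Continuous (dysonTerm F u n) := by
  induction n with
  | zero => exact continuous_const
  | succ n ih =>
    exact continuous_iff_continuousAt.2 fun t =>
      (hasDerivAt_dysonTerm_succ n u (continuous_clm_apply_of_strong hF hM ih) t).continuousAt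

/-- The factorial comes from integrating powers: each further integration turns `s ^ n` into `s ^ (n
+ 1) / (n + 1)`. -/
theorem norm_dysonTerm_le (hM0 : 0 ≤ M) (hM : ∀ t, ‖F t‖ ≤ M) (u : H) (n : ℕ) (t : ℝ) :
    ‖dysonTerm F u n t‖ ≤ (M * |t|) ^ n / n.factorial * ‖u‖ := by
  induction n generalizing t with
  | zero => simp [dysonTerm]
  | succ n ih =>
    -- Rescaling the integral to `[0, 1]` treats both signs of `t` at once.
    have e : dysonTerm F u (n + 1) t
        = t • ∫ r in (0 : ℝ)..1, F (t * r) (dysonTerm F u n (t * r)) := by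
      rw [intervalIntegral.smul_integral_comp_mul_left (fun s => F s (dysonTerm F u n s))]
      simp [dysonTerm]
    have hb : ‖∫ r in (0 : ℝ)..1, F (t * r) (dysonTerm F u n (t * r))‖
        ≤ ∫ r in (0 : ℝ)..1, M * ((M * |t|) ^ n / n.factorial * ‖u‖) * r ^ n := by
      refine intervalIntegral.norm_integral_le_of_norm_le zero_le_one
        (Eventually.of_forall fun r hr => ?_) (Continuous.intervalIntegrable (by fun_prop) _ _)
      refine ((F (t * r)).le_of_opNorm_le (hM _) _).trans ?_
      rw [mul_assoc]
      refine mul_le_mul_of_nonneg_left ((ih _).trans (le_of_eq ?_)) hM0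
      rw [abs_mul, abs_of_pos hr.1]
      ring
    rw [e, norm_smul, Real.norm_eq_abs]
    refine (mul_le_mul_of_nonneg_left hb (abs_nonneg t)).trans (le_of_eq ?_)
    rw [intervalIntegral.integral_const_mul, integral_pow, Nat.factorial_succ]
    push_cast
    have h1 : ((n : ℝ) + 1) ≠ 0 := by positivity
    have h2 : (n.factorial : ℝ) ≠ 0 := by positivity
    field_simp
    simp
    ring

/-- Global existence for the linear equation `y' = F(t) y` with a strongly continuous and bounded
family `F`. -/
theorem exists_linearODE_solution [CompleteSpace H] (hF : ∀ x, Continuous fun t => F t x)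
    (hM : ∀ t, ‖F t‖ ≤ M) (u : H) :
    ∃ y : ℝ → H, y 0 = u ∧ ∀ t, HasDerivAt y (F t (y t)) t := by
  have hM0 : 0 ≤ M := (norm_nonneg _).trans (hM 0)
  have hsum : ∀ t, Summable fun n => dysonTerm F u n t := fun t =>
    Summable.of_norm_bounded ((Real.summable_pow_div_factorial (M * |t|)).mul_right ‖u‖)
      (norm_dysonTerm_le hM0 hM u · t)
  have hcont := continuous_dysonTerm hF hM u
  refine ⟨fun t => ∑' n, dysonTerm F u n t, ?_, fun t => ?_⟩
  · change ∑' n, dysonTerm F u n 0 = u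
    rw [tsum_eq_single 0]
    · rfl
    · intro n hn
      obtain ⟨m, rfl⟩ := Nat.exists_eq_succ_of_ne_zero hn
      simp [dysonTerm]
  -- A ball containing both `0` and `t`, on which the derivatives of the terms have a uniform
  -- summable bound, so that the series may be differentiated termwise.
  · set T : ℝ := |t| + 1
    have hder : HasDerivAt (fun t => ∑' n, dysonTerm F u (n + 1) t)
        (∑' n, F t (dysonTerm F u n t)) t := by
      have hb : ∀ n, ∀ s ∈ Metric.ball (0 : ℝ) T,
          ‖F s (dysonTerm F u n s)‖ ≤ M * ((M * T) ^ n / n.factorial * ‖u‖) := by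
        intro n s hs
        refine ((F s).le_of_opNorm_le (hM s) _).trans (mul_le_mul_of_nonneg_left ?_ hM0)
        refine (norm_dysonTerm_le hM0 hM u n s).trans ?_
        have : |s| ≤ T := by simpa using (Metric.mem_ball.1 hs).le
        gcongr
      have ht : t ∈ Metric.ball (0 : ℝ) T := by simp [T]
      have h0 : (0 : ℝ) ∈ Metric.ball (0 : ℝ) T := Metric.mem_ball_self (by positivity)
      exact hasDerivAt_tsum_of_isPreconnected (g := fun n => dysonTerm F u (n + 1))
        (g' := fun n s => F s (dysonTerm F u n s))
        (((Real.summable_pow_div_factorial (M * T)).mul_right ‖u‖).mul_left M)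
        Metric.isOpen_ball (convex_ball (0 : ℝ) T).isPreconnected
        (fun n s _ => hasDerivAt_dysonTerm_succ n u
          (continuous_clm_apply_of_strong hF hM (hcont n)) s) hb h0
        ((summable_nat_add_iff 1).2 (hsum 0)) ht
    have h1 : (fun t => ∑' n, dysonTerm F u n t)
        = fun t => u + ∑' n, dysonTerm F u (n + 1) t := by
      funext s
      rw [(hsum s).tsum_eq_zero_add]
      rfl
    rw [(F t).map_tsum (hsum t), h1]
    exact hder.const_add u

/-- Solutions of `y' = F(t) y` with skew `F(t)` have constant norm. -/
theorem norm_eq_of_linearODE (hskew : ∀ t x, (inner ℂ x (F t x)).re = 0) {y : ℝ → H}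
    (hy : ∀ t, HasDerivAt y (F t (y t)) t) (t : ℝ) : ‖y t‖ = ‖y 0‖ := by
  let : InnerProductSpace ℝ H := InnerProductSpace.rclikeToReal ℂ H
  have hd : ∀ s, HasDerivAt (fun s => ‖y s‖ ^ 2) 0 s := by
    intro s
    refine (hy s).norm_sq.congr_deriv ?_
    have : inner ℝ (y s) (F s (y s)) = (inner ℂ (y s) (F s (y s))).re := rfl
    rw [this, hskew, mul_zero]
  have := is_const_of_deriv_eq_zero (fun s => (hd s).differentiableAt) (fun s => (hd s).deriv) t 0
  exact (sq_eq_sq₀ (norm_nonneg _) (norm_nonneg _)).1 this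

/-- The solution operators of `y' = F(t) y` with skew `F(t)`. -/
theorem exists_linearODE_propagator [CompleteSpace H] (hF : ∀ x, Continuous fun t => F t x)
    (hM : ∀ t, ‖F t‖ ≤ M) (hskew : ∀ t x, (inner ℂ x (F t x)).re = 0) :
    ∃ W : ℝ → H →ₗᵢ[ℂ] H, (∀ u, W 0 u = u) ∧ (∀ u t, HasDerivAt (W · u) (F t (W t u)) t) ∧
      ∀ y : ℝ → H, (∀ t, HasDerivAt y (F t (y t)) t) → ∀ t, y t = W t (y 0) := by
  choose y hy0 hy using exists_linearODE_solution hF hM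
  -- The difference of two solutions is a solution, hence of constant norm. This uniqueness also
  -- yields the linearity of the solution operators.
  have huniq : ∀ z z' : ℝ → H, (∀ t, HasDerivAt z (F t (z t)) t) →
      (∀ t, HasDerivAt z' (F t (z' t)) t) → z 0 = z' 0 → ∀ t, z t = z' t := by
    intro z z' hz hz' h t
    have := norm_eq_of_linearODE hskew (y := z - z') (fun t => by
      simpa using (hz t).sub (hz' t)) t
    simpa [h, sub_eq_zero] using this
  refine ⟨fun t => ⟨⟨⟨fun u => y u t, fun u v => ?_⟩, fun c u => ?_⟩, fun u => ?_⟩, hy0, hy,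
    fun z hz t => huniq _ _ hz (hy _) (hy0 _).symm t⟩
  · exact huniq (y (u + v)) (y u + y v) (hy _) (fun t => by simpa using (hy u t).add (hy v t))
      (by simp [hy0]) t
  · exact huniq (y (c • u)) (c • y u) (hy _) (fun t => by simpa using (hy u t).const_smul c)
      (by simp [hy0]) t
  · exact (norm_eq_of_linearODE hskew (hy u) t).trans (by rw [hy0])

/-- A bounded symmetric perturbation of the generator of a unitary group generates a unitary
group. -/
theorem IsUnitaryGroupOf.exists_perturbation [CompleteSpace H] {A A' : H →ₗ.[ℂ] H}
    {U : ℝ → (H ≃ₗᵢ[ℂ] H)} (h : IsUnitaryGroupOf A U) (B : H →L[ℂ] H)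
    (hB : ∀ x, (inner ℂ x (B x)).im = 0)
    (hA' : ∀ u f, (u, f) ∈ A'.graph ↔ (u, f - B u) ∈ A.graph) :
    ∃ U' : ℝ → (H ≃ₗᵢ[ℂ] H), IsUnitaryGroupOf A' U' := by
  have hcomp : ∀ {y : ℝ → H}, Continuous y → Continuous fun t => U t (y t) := by
    intro y hy
    refine continuous_clm_apply_of_strong
      (F := fun t => (U t).toContinuousLinearEquiv.toContinuousLinearMap) (M := 1)
      h.strongly_continuous (fun t => ?_) hy
    exact ContinuousLinearMap.opNorm_le_bound _ zero_le_one fun x => by simp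
  -- Interaction picture: if `W` solves `W' = F W`, then `U t ∘ W t` is formally `e^{-it(A + B)}`,
  -- and `F` is bounded although `A` need not be.
  let F : ℝ → H →L[ℂ] H := fun t => -(Complex.I •
    ((U (-t)).toContinuousLinearEquiv.toContinuousLinearMap ∘L B ∘L
      (U t).toContinuousLinearEquiv.toContinuousLinearMap))
  have hFa : ∀ t x, F t x = -(Complex.I • U (-t) (B (U t x))) := fun t x => rfl
  have hinv : ∀ t x, U t (U (-t) x) = x := fun t x => by
    rw [← h.add_apply, add_neg_cancel, h.zero_apply]
  have hFc : ∀ x, Continuous fun t => F t x := by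
    intro x
    simp only [hFa]
    have h1 : Continuous fun t => U t (B (U (-t) x)) :=
      hcomp (B.continuous.comp ((h.strongly_continuous x).comp continuous_neg))
    have h2 := h1.comp continuous_neg
    simp only [Function.comp_def, neg_neg] at h2
    exact (h2.const_smul _).neg
  have hFM : ∀ t, ‖F t‖ ≤ ‖B‖ := fun t =>
    ContinuousLinearMap.opNorm_le_bound _ (norm_nonneg _) fun x => by
      rw [hFa, norm_neg, norm_smul, Complex.norm_I, one_mul, LinearIsometryEquiv.norm_map]
      simpa using B.le_opNorm (U t x)
  have hskew : ∀ t x, (inner ℂ x (F t x)).re = 0 := by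
    intro t x
    have e : inner ℂ x (U (-t) (B (U t x))) = inner ℂ (U t x) (B (U t x)) := by
      rw [← (U t).inner_map_map, hinv]
    rw [hFa, inner_neg_right, inner_smul_right, e]
    simp [hB]
  obtain ⟨W, hW0, hW, hWu⟩ := exists_linearODE_propagator hFc hFM hskew
  -- Because `U t ∘ F (s + t) = F s ∘ U t`, the curve `s ↦ U t (W (s + t) u)` solves the same
  -- equation, and uniqueness identifies it.
  have hadd : ∀ s t u, U (s + t) (W (s + t) u) = U s (W s (U t (W t u))) := by
    intro s t u
    have hz : ∀ s, HasDerivAt (fun s => U t (W (s + t) u)) (F s (U t (W (s + t) u))) s := by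
      intro s
      have h1 := ((U t).toContinuousLinearEquiv.toContinuousLinearMap.restrictScalars
        ℝ).hasFDerivAt.comp_hasDerivAt s ((hW u (s + t)).comp_add_const s t)
      refine h1.congr_deriv ?_
      change U t (F (s + t) (W (s + t) u)) = _
      rw [hFa, hFa, map_neg, map_smul, ← h.add_apply, ← h.add_apply]
      simp
    have h2 := hWu _ hz s
    simp only [zero_add] at h2
    rw [← h2, ← h.add_apply]
  refine exists_isUnitaryGroupOf A' (fun t => (U t).toLinearIsometry.comp (W t))
    (fun u => ?_) hadd (fun u => ?_) (fun u w => ?_)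
  · change U 0 (W 0 u) = u
    rw [h.zero_apply, hW0]
  · exact hcomp (continuous_iff_continuousAt.2 fun t => (hW u t).continuousAt)
  · change HasDerivAt (fun t => U t (W t u)) w 0 ↔ _
    -- This part is differentiable for every `u`, so `U t (W t u)` is differentiable at `0` exactly
    -- when `U t u` is; the domain is unchanged and the generator gains `-iB`.
    have hdiff : HasDerivAt (fun t => U t (W t u - u)) (-(Complex.I • B u)) 0 := by
      have hd := hW u 0
      rw [hFa, hW0, h.zero_apply, neg_zero, h.zero_apply, hasDerivAt_iff_tendsto_slope] at hd
      rw [hasDerivAt_iff_tendsto_slope]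
      have hz : Tendsto (fun t => slope (W · u) 0 t - -(Complex.I • B u)) (𝓝[≠] 0) (𝓝 0) := by
        simpa using hd.sub_const (-(Complex.I • B u))
      have h1 : Tendsto (fun t => U t (slope (W · u) 0 t - -(Complex.I • B u))) (𝓝[≠] 0)
          (𝓝 0) := by
        rw [tendsto_zero_iff_norm_tendsto_zero] at hz ⊢
        simpa only [LinearIsometryEquiv.norm_map] using hz
      have h2 : Tendsto (fun t => U t (-(Complex.I • B u))) (𝓝[≠] 0) (𝓝 (-(Complex.I • B u))) := by
        have := (h.strongly_continuous (-(Complex.I • B u))).tendsto 0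
        rw [h.zero_apply] at this
        exact this.mono_left nhdsWithin_le_nhds
      have h3 := h1.add h2
      rw [zero_add] at h3
      refine h3.congr fun t => ?_
      rw [← map_add, sub_add_cancel, slope_def_module, slope_def_module, hW0, sub_self, map_zero,
        sub_zero, sub_zero]
      exact ((U t).toContinuousLinearEquiv.toContinuousLinearMap.restrictScalars ℝ).map_smul _ _
    rw [hA', ← show Complex.I • (w - -(Complex.I • B u)) = Complex.I • w - B u by
      rw [sub_neg_eq_add, smul_add, smul_smul, Complex.I_mul_I, neg_one_smul, sub_eq_add_neg],
      ← h.hasDerivAt_iff]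
    constructor
    · intro hw
      refine (hw.sub hdiff).congr_of_eventuallyEq (Eventually.of_forall fun t => ?_)
      simp
    · intro hw
      have := hw.add hdiff
      rw [sub_add_cancel] at this
      refine this.congr_of_eventuallyEq (Eventually.of_forall fun t => ?_)
      simp

end LinearODE

/-! ### Multiplication operators on `L²` and the groups they generate. -/

section Multiplication

variable {α : Type*} [MeasurableSpace α] {μ : Measure α}

/-- Dominated convergence in `L²`. -/
theorem tendsto_L2_of_dominated {ι : Type*} {l : Filter ι} [l.IsCountablyGenerated]
    {f : ι → Lp ℂ 2 μ} {g : Lp ℂ 2 μ} {F : ι → α → ℂ} {G : α → ℂ} {b : α → ℝ}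
    (hF : ∀ i, f i =ᵐ[μ] F i) (hG : g =ᵐ[μ] G) (hb : MemLp b 2 μ)
    (hle : ∀ i, ∀ᵐ x ∂μ, ‖F i x - G x‖ ≤ b x)
    (hlim : ∀ᵐ x ∂μ, Tendsto (F · x) l (𝓝 (G x))) : Tendsto f l (𝓝 g) := by
  rw [Lp.tendsto_Lp_iff_tendsto_eLpNorm']
  have e : ∀ i, eLpNorm (f i - g : α → ℂ) 2 μ
      = (∫⁻ x, ‖f i x - g x‖ₑ ^ (2 : ℝ) ∂μ) ^ (1 / 2 : ℝ) := by
    intro i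
    rw [eLpNorm_eq_lintegral_rpow_enorm_toReal (by norm_num) (by norm_num)]
    simp
  simp only [e]
  have hz : Tendsto (fun i => ∫⁻ x, ‖f i x - g x‖ₑ ^ (2 : ℝ) ∂μ) l (𝓝 (∫⁻ _, 0 ∂μ)) := by
    have hm : ∀ i, AEMeasurable (fun x => ‖F i x - G x‖ₑ ^ (2 : ℝ)) μ := by
      intro i
      have h1 := (((Lp.aestronglyMeasurable (f i)).congr (hF i)).sub
        ((Lp.aestronglyMeasurable g).congr hG)).enorm
      exact h1.pow_const _
    have hc : ∀ i, ∫⁻ x, ‖f i x - g x‖ₑ ^ (2 : ℝ) ∂μ = ∫⁻ x, ‖F i x - G x‖ₑ ^ (2 : ℝ) ∂μ := by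
      intro i
      refine lintegral_congr_ae ?_
      filter_upwards [hF i, hG] with x h1 h2
      rw [h1, h2]
    simp only [hc]
    refine tendsto_lintegral_filter_of_dominated_convergence' (fun x => ‖b x‖ₑ ^ (2 : ℝ))
      (Eventually.of_forall hm) (Eventually.of_forall fun i => ?_) ?_ ?_
    · filter_upwards [hle i] with x hx
      gcongr
      rw [enorm_le_iff_norm_le]
      exact hx.trans (le_abs_self _)
    · have := lintegral_rpow_enorm_lt_top_of_eLpNorm_lt_top (by norm_num) (by norm_num) hb.2
      simpa using this.ne
    · filter_upwards [hlim] with x hx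
      have h1 : Tendsto (fun i => ‖F i x - G x‖ₑ) l (𝓝 0) := by
        simpa using (hx.sub_const (G x)).enorm
      simpa [Function.comp_def] using
        (ENNReal.continuous_rpow_const (y := 2)).tendsto 0 |>.comp h1
  rw [lintegral_zero] at hz
  simpa [Function.comp_def] using
    (ENNReal.continuous_rpow_const (y := (1 / 2 : ℝ))).tendsto 0 |>.comp hz

/-- Multiplication by a bounded function is a bounded operator on `L²`. -/
theorem exists_mul_clm {g : α → ℂ} (hg : AEStronglyMeasurable g μ) {C : ℝ}
    (hC : ∀ x, ‖g x‖ ≤ C) :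
    ∃ B : Lp ℂ 2 μ →L[ℂ] Lp ℂ 2 μ, ∀ u, B u =ᵐ[μ] fun x => g x * u x := by
  have hmem : ∀ u : Lp ℂ 2 μ, MemLp (fun x => g x * u x) 2 μ := fun u =>
    (Lp.memLp u).of_le_mul (hg.mul (Lp.aestronglyMeasurable u))
      (Eventually.of_forall fun x => by
        rw [norm_mul]
        exact mul_le_mul_of_nonneg_right (hC x) (norm_nonneg _))
  refine ⟨LinearMap.mkContinuous ⟨⟨fun u => (hmem u).toLp, fun u v => ?_⟩, fun c u => ?_⟩ C
    fun u => ?_, fun u => (hmem u).coeFn_toLp⟩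
  · refine Lp.ext ?_
    filter_upwards [(hmem (u + v)).coeFn_toLp, (hmem u).coeFn_toLp, (hmem v).coeFn_toLp,
      Lp.coeFn_add u v, Lp.coeFn_add (hmem u).toLp (hmem v).toLp] with x h1 h2 h3 h4 h5
    rw [h1, h5, Pi.add_apply, h2, h3, h4, Pi.add_apply, mul_add]
  · refine Lp.ext ?_
    filter_upwards [(hmem (c • u)).coeFn_toLp, (hmem u).coeFn_toLp,
      Lp.coeFn_smul c u, Lp.coeFn_smul c (hmem u).toLp] with x h1 h2 h3 h4
    simp only [RingHom.id_apply]
    rw [h1, h4, Pi.smul_apply, h2, h3, Pi.smul_apply, smul_eq_mul, smul_eq_mul]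
    ring
  · refine Lp.norm_le_mul_norm_of_ae_le_mul ?_
    filter_upwards [(hmem u).coeFn_toLp] with x hx
    simp only [LinearMap.coe_mk, AddHom.coe_mk]
    rw [hx, norm_mul]
    exact mul_le_mul_of_nonneg_right (hC x) (norm_nonneg _)

/-- Multiplication by a unimodular function is an isometry of `L²`. -/
theorem exists_mul_linearIsometry {g : α → ℂ} (hg : AEStronglyMeasurable g μ)
    (h1 : ∀ x, ‖g x‖ = 1) :
    ∃ B : Lp ℂ 2 μ →ₗᵢ[ℂ] Lp ℂ 2 μ, ∀ u, B u =ᵐ[μ] fun x => g x * u x := by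
  obtain ⟨B, hB⟩ := exists_mul_clm hg fun x => (h1 x).le
  refine ⟨⟨B.toLinearMap, fun u => ?_⟩, hB⟩
  change ‖B u‖ = ‖u‖
  have h : ∀ᵐ x ∂μ, ‖B u x‖ = ‖u x‖ := by
    filter_upwards [hB u] with x hx
    rw [hx, norm_mul, h1, one_mul]
  exact le_antisymm (Lp.norm_le_norm_of_ae_le (h.mono fun x hx => hx.le))
    (Lp.norm_le_norm_of_ae_le (h.mono fun x hx => hx.ge))

theorem norm_exp_neg_I_mul_ofReal (s : ℝ) : ‖Complex.exp (-(Complex.I * s))‖ = 1 := by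
  have := Complex.norm_exp_ofReal_mul_I (-s)
  rwa [Complex.ofReal_neg, neg_mul, mul_comm] at this

theorem norm_exp_neg_I_mul_ofReal_sub_one_le (s : ℝ) :
    ‖Complex.exp (-(Complex.I * s)) - 1‖ ≤ |s| := by
  have := Real.norm_exp_I_mul_ofReal_sub_one_le (x := -s)
  simpa using this

theorem hasDerivAt_exp_neg_I_mul (c : ℝ) :
    HasDerivAt (fun t : ℝ => Complex.exp (-(Complex.I * (t * c : ℝ)))) (-(Complex.I * c)) 0 := by
  have h : HasDerivAt (fun t : ℝ => -(Complex.I * ((t * c : ℝ) : ℂ))) (-(Complex.I * c)) 0 := by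
    have := (((hasDerivAt_id (0 : ℝ)).mul_const c).ofReal_comp.const_mul Complex.I).neg
    simpa [Pi.neg_def] using this
  simpa using h.cexp

/-- The unitary group of multiplication operators `e^{-itm}` on `L²`, and its generator: the
derivative at `u` is `w` if and only if `w = -imu`. -/
theorem exists_mul_group {m : α → ℝ} (hm : Measurable m) :
    ∃ M : ℝ → Lp ℂ 2 μ →ₗᵢ[ℂ] Lp ℂ 2 μ,
      (∀ u, M 0 u = u) ∧ (∀ s t u, M (s + t) u = M s (M t u)) ∧
      (∀ u, Continuous fun t => M t u) ∧
      ∀ u w, HasDerivAt (fun t => M t u) w 0 ↔ w =ᵐ[μ] fun x => -(Complex.I * m x) * u x := by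
  let e : ℝ → α → ℂ := fun t x => Complex.exp (-(Complex.I * (t * m x : ℝ)))
  have he1 : ∀ t x, ‖e t x‖ = 1 := fun t x => norm_exp_neg_I_mul_ofReal _
  have headd : ∀ s t x, e (s + t) x = e s x * e t x := by
    intro s t x
    simp only [e, ← Complex.exp_add]
    congr 1
    push_cast
    ring
  have hem : ∀ t, AEStronglyMeasurable (e t) μ := fun t => by
    refine (Measurable.aestronglyMeasurable ?_)
    fun_prop
  choose M hM using fun t => exists_mul_linearIsometry (hem t) (he1 t)
  have hM0 : ∀ u, M 0 u = u := fun u => by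
    refine Lp.ext ?_
    filter_upwards [hM 0 u] with x hx
    rw [hx]
    simp [e]
  have hadd : ∀ s t u, M (s + t) u = M s (M t u) := fun s t u => by
    refine Lp.ext ?_
    filter_upwards [hM (s + t) u, hM s (M t u), hM t u] with x h1 h2 h3
    rw [h1, h2, h3, headd, mul_assoc]
  have hc0 : ∀ u, Tendsto (fun t => M t u) (𝓝 0) (𝓝 u) := by
    intro u
    refine tendsto_L2_of_dominated (F := fun t x => e t x * u x) (G := u)
      (b := fun x => 2 * ‖u x‖) (hM · u) EventuallyEq.rfl ((Lp.memLp u).norm.const_mul 2)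
      (fun t => Eventually.of_forall fun x => ?_) (Eventually.of_forall fun x => ?_)
    · refine (norm_sub_le _ _).trans (le_of_eq ?_)
      rw [norm_mul, he1]
      ring
    · have := ((hasDerivAt_exp_neg_I_mul (m x)).continuousAt.tendsto).mul_const (u x)
      simpa [e] using this
  refine ⟨M, hM0, hadd, fun u => ?_, fun u w => ?_⟩
  · rw [continuous_iff_continuousAt]
    intro s
    have h1 : Tendsto (fun t : ℝ => t - s) (𝓝 s) (𝓝 0) := by
      have : ContinuousAt (fun t : ℝ => t - s) s := by fun_prop
      simpa [ContinuousAt] using this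
    refine (((M s).continuous.tendsto u).comp ((hc0 u).comp h1)).congr fun t => ?_
    simp [← hadd]
  have hslope : ∀ t, slope (fun t => M t u) 0 t =ᵐ[μ]
      fun x => (t : ℂ)⁻¹ * (e t x - 1) * u x := by
    intro t
    have h0 : slope (fun t => M t u) 0 t = ((t⁻¹ : ℝ) : ℂ) • (M t u - u) := by
      rw [slope_def_module, hM0, sub_zero]
      rfl
    rw [h0]
    filter_upwards [Lp.coeFn_smul ((t⁻¹ : ℝ) : ℂ) (M t u - u), Lp.coeFn_sub (M t u) u, hM t u]
      with x h1 h2 h3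
    rw [h1, Pi.smul_apply, h2, Pi.sub_apply, h3, smul_eq_mul]
    push_cast
    ring
  have hpt : ∀ x, Tendsto (fun t : ℝ => (t : ℂ)⁻¹ * (e t x - 1) * u x) (𝓝[≠] 0)
      (𝓝 (-(Complex.I * m x) * u x)) := by
    intro x
    have h1 := (hasDerivAt_iff_tendsto_slope.1 (hasDerivAt_exp_neg_I_mul (m x))).mul_const (u x)
    refine h1.congr fun t => ?_
    rw [slope_def_module]
    simp [e]
  rw [hasDerivAt_iff_tendsto_slope]
  constructor
  · intro h
    -- An `L²` limit is an almost everywhere limit along a subsequence, which identifies it with the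
    -- pointwise derivative.
    have h1 := tendstoInMeasure_of_tendsto_Lp h
    obtain ⟨ns, hns, hae⟩ := h1.exists_seq_tendsto_ae'
    have hall : ∀ᵐ x ∂μ, ∀ k, slope (fun t => M t u) 0 (ns k) x
        = ((ns k : ℝ) : ℂ)⁻¹ * (e (ns k) x - 1) * u x := ae_all_iff.2 fun k => hslope (ns k)
    filter_upwards [hae, hall] with x h2 h3
    refine tendsto_nhds_unique h2 ?_
    simp only [h3]
    exact (hpt x).comp hns
  · intro hw
    -- Since `|e^{-is} - 1| ≤ |s|`, the quotients are bounded by `|m u| = |w|`, so their distance to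
    -- `w` is dominated by `2|w|`. At `t = 0` the convention `0⁻¹ = 0` makes the bound trivial.
    have hwm : MemLp (fun x => 2 * ‖w x‖) 2 μ := (Lp.memLp w).norm.const_mul 2
    refine tendsto_L2_of_dominated hslope hw hwm (fun t => ?_) (Eventually.of_forall hpt)
    filter_upwards [hw] with x hx
    have hn : ‖w x‖ = |m x| * ‖u x‖ := by
      rw [hx]
      simp
    have h2 : ‖(t : ℂ)⁻¹ * (e t x - 1) * u x‖ ≤ ‖w x‖ := by
      rw [norm_mul, hn]
      refine mul_le_mul_of_nonneg_right ?_ (norm_nonneg _)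
      rw [norm_mul, norm_inv, Complex.norm_real, Real.norm_eq_abs]
      have h3 := norm_exp_neg_I_mul_ofReal_sub_one_le (t * m x)
      rw [abs_mul] at h3
      rcases eq_or_ne t 0 with rfl | ht
      · simp
      · rw [inv_mul_le_iff₀ (abs_pos.2 ht)]
        exact h3
    refine (norm_sub_le _ _).trans ?_
    rw [← hx]
    linarith

end Multiplication

/-! ### From compactly supported to Schwartz test functions. -/

section WeakLaplacian

open SchwartzMap

variable {n : ℕ}

theorem laplacian_ofReal {φ : Eucl n → ℝ} (hφ : ContDiff ℝ ∞ φ) (x : Eucl n) :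
    (Δ (fun x => (φ x : ℂ))) x = ((Δ φ) x : ℂ) :=
  ContDiffAt.laplacian_CLM_comp_left (l := Complex.ofRealCLM)
    ((contDiff_infty.mp hφ 2).contDiffAt (x := x))

theorem contDiff_ofReal_comp {φ : Eucl n → ℝ} (hφ : ContDiff ℝ ∞ φ) :
    ContDiff ℝ ∞ (fun x => (φ x : ℂ)) :=
  Complex.ofRealCLM.contDiff.comp hφ

theorem hasCompactSupport_ofReal_comp {φ : Eucl n → ℝ} (hc : HasCompactSupport φ) :
    HasCompactSupport (fun x => (φ x : ℂ)) :=
  hc.comp_left (g := fun r : ℝ => (r : ℂ)) Complex.ofReal_zero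

theorem norm_laplacian_le (f : Eucl n → ℂ) (x : Eucl n) :
    ‖(Δ f) x‖ ≤ n * ‖iteratedFDeriv ℝ 2 f x‖ := by
  rw [InnerProductSpace.laplacian_eq_iteratedFDeriv_stdOrthonormalBasis]
  refine (norm_sum_le _ _).trans ?_
  refine (Finset.sum_le_card_nsmul _ _ ‖iteratedFDeriv ℝ 2 f x‖ fun i _ => ?_).trans (by simp)
  refine (ContinuousMultilinearMap.le_opNorm _ _).trans (le_of_eq ?_)
  simp [Fin.prod_univ_two]

/-- Smooth compactly supported functions `χ_k`, equal to one on larger and larger balls, whose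
derivatives of order at most two are bounded uniformly in `k`. -/
theorem exists_cutoff_seq (n : ℕ) : ∃ (χ : ℕ → Eucl n → ℝ) (K : ℝ),
    (∀ k, ContDiff ℝ ∞ (χ k)) ∧ (∀ k, HasCompactSupport (χ k)) ∧
    (∀ x, ∀ᶠ k in atTop, χ k =ᶠ[𝓝 x] 1) ∧
    ∀ k, ∀ i ≤ 2, ∀ x, ‖iteratedFDeriv ℝ i (χ k) x‖ ≤ K := by
  let b : ContDiffBump (0 : Eucl n) := ⟨1, 2, one_pos, one_lt_two⟩
  have hb : ContDiff ℝ ∞ (b : Eucl n → ℝ) := b.contDiff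
  have hbi : ∀ i : ℕ, ∃ C, ∀ x, ‖iteratedFDeriv ℝ i (b : Eucl n → ℝ) x‖ ≤ C := fun i =>
    (b.hasCompactSupport.iteratedFDeriv (𝕜 := ℝ) i).exists_bound_of_continuous
      ((contDiff_infty.mp hb i).continuous_iteratedFDeriv (m := i) le_rfl)
  choose C hC using hbi
  have ha : ∀ k : ℕ, (0 : ℝ) < ((k : ℝ) + 1)⁻¹ := fun k => by positivity
  refine ⟨fun k x => b (((k : ℝ) + 1)⁻¹ • x), max (C 0) (max (C 1) (C 2)), fun k => ?_, fun k => ?_,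
    fun x => ?_, fun k i hi x => ?_⟩
  · exact hb.comp (contDiff_const_smul _)
  · exact b.hasCompactSupport.comp_smul (ha k).ne'
  · have hev : ∀ᶠ k : ℕ in atTop, ‖x‖ < k := tendsto_natCast_atTop_atTop.eventually_gt_atTop _
    filter_upwards [hev] with k hk
    have hx : x ∈ Metric.ball (0 : Eucl n) ((k : ℝ) + 1) := by
      rw [mem_ball_zero_iff]
      linarith
    filter_upwards [Metric.isOpen_ball.mem_nhds hx] with y hy
    refine b.one_of_mem_closedBall ?_
    rw [mem_closedBall_zero_iff, norm_smul, Real.norm_eq_abs, abs_of_pos (ha k),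
      inv_mul_le_iff₀ (by positivity)]
    simpa [b] using (mem_ball_zero_iff.1 hy).le
  · rw [iteratedFDeriv_comp_const_smul _ (contDiff_infty.mp hb i), norm_smul]
    have h1 : ‖(((k : ℝ) + 1)⁻¹) ^ i‖ ≤ 1 := by
      rw [norm_pow, Real.norm_eq_abs, abs_of_pos (ha k)]
      refine pow_le_one₀ (ha k).le (inv_le_one_of_one_le₀ ?_)
      linarith [(Nat.cast_nonneg k : (0 : ℝ) ≤ k)]
    refine (mul_le_of_le_one_left (norm_nonneg _) h1).trans ((hC i _).trans ?_)
    interval_cases i <;> simp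

/-- `-Δu = f` can be tested against Schwartz functions. -/
theorem weakSchrodinger_zero_iff_schwartz (u f : L2 n) :
    WeakSchrodinger (fun _ => 0) u f ↔
      ∀ ψ : 𝓢(Eucl n, ℂ), ∫ x, (Δ ψ) x * u x = -∫ x, ψ x * f x := by
  have hprod : ∀ {g : Eucl n → ℂ} (v : L2 n), MemLp g 2 volume →
      Integrable (fun x => g x * v x) volume := fun v hg => hg.integrable_mul (Lp.memLp v)
  constructor
  · rintro ⟨-, h⟩ ψ
    have hreal : ∀ φ : Eucl n → ℝ, ContDiff ℝ ∞ φ → HasCompactSupport φ →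
        ∫ x, ((Δ φ) x : ℂ) * u x = -∫ x, (φ x : ℂ) * f x := by
      intro φ h1 h2
      have := h φ h1 h2
      simp only [zero_smul, smul_zero, integral_zero, add_zero, neg_smul, integral_neg] at this
      simp only [Complex.real_smul] at this
      rw [← this, neg_neg]
    have hcpx : ∀ φ : Eucl n → ℂ, ContDiff ℝ ∞ φ → HasCompactSupport φ →
        ∫ x, (Δ φ) x * u x = -∫ x, φ x * f x := by
      intro φ h1 h2
      have h2at : ∀ x, ContDiffAt ℝ 2 φ x := fun x => (contDiff_infty.mp h1 2).contDiffAt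
      have hre : ContDiff ℝ ∞ fun x => (φ x).re := Complex.reCLM.contDiff.comp h1
      have him : ContDiff ℝ ∞ fun x => (φ x).im := Complex.imCLM.contDiff.comp h1
      have hrec : HasCompactSupport fun x => (φ x).re := h2.comp_left Complex.zero_re
      have himc : HasCompactSupport fun x => (φ x).im := h2.comp_left Complex.zero_im
      have er : ∀ x, (Δ fun x => (φ x).re) x = ((Δ φ) x).re := fun x =>
        ContDiffAt.laplacian_CLM_comp_left (l := Complex.reCLM) (h2at x)
      have ei : ∀ x, (Δ fun x => (φ x).im) x = ((Δ φ) x).im := fun x =>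
        ContDiffAt.laplacian_CLM_comp_left (l := Complex.imCLM) (h2at x)
      have hint : ∀ {g : Eucl n → ℝ} (v : L2 n), Continuous g → HasCompactSupport g →
          Integrable (fun x => (g x : ℂ) * v x) volume := fun v hg hc =>
        hprod v ((Complex.continuous_ofReal.comp hg).memLp_of_hasCompactSupport
          (hc.comp_left (g := fun r : ℝ => (r : ℂ)) Complex.ofReal_zero))
      have e1 : ∫ x, (Δ φ) x * u x = (∫ x, ((Δ fun x => (φ x).re) x : ℂ) * u x)
          + Complex.I * ∫ x, ((Δ fun x => (φ x).im) x : ℂ) * u x := by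
        rw [← integral_const_mul, ← integral_add
          (hint u (continuous_laplacian hre) (compact_laplacian hrec))
          ((hint u (continuous_laplacian him) (compact_laplacian himc)).const_mul _)]
        refine integral_congr_ae (Eventually.of_forall fun x => ?_)
        simp only [er, ei]
        rw [← mul_assoc, ← add_mul, mul_comm Complex.I, Complex.re_add_im]
      have e2 : ∫ x, φ x * f x = (∫ x, ((φ x).re : ℂ) * f x)
          + Complex.I * ∫ x, ((φ x).im : ℂ) * f x := by
        rw [← integral_const_mul, ← integral_add (hint f hre.continuous hrec)
          ((hint f him.continuous himc).const_mul _)]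
        refine integral_congr_ae (Eventually.of_forall fun x => ?_)
        simp only
        rw [← mul_assoc, ← add_mul, mul_comm Complex.I, Complex.re_add_im]
      rw [e1, e2, hreal _ hre hrec, hreal _ him himc]
      ring
    -- Test with `χ k • ψ`: by the Leibniz rule its Laplacian is dominated, uniformly in `k`, by
    -- derivatives of `ψ` of order at most two, which are in `L²`.
    obtain ⟨χ, K, hχs, hχc, hχ1, hχK⟩ := exists_cutoff_seq n
    have hψ : ContDiff ℝ ∞ ψ := ψ.smooth'
    have hk := fun k => hcpx (fun x => χ k x • ψ x) ((hχs k).smul hψ) ((hχc k).smul_right)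
    let D1 : 𝓢(Eucl n, Eucl n →L[ℝ] ℂ) := fderivCLM ℝ (Eucl n) ℂ ψ
    let D2 : 𝓢(Eucl n, Eucl n →L[ℝ] Eucl n →L[ℝ] ℂ) := fderivCLM ℝ (Eucl n) _ D1
    have hK0 : 0 ≤ K := (norm_nonneg _).trans (hχK 0 0 (by norm_num) 0)
    have hD0 : ∀ x, ‖iteratedFDeriv ℝ (2 - 2) ψ x‖ = ‖ψ x‖ := fun x => norm_iteratedFDeriv_zero
    have hD1 : ∀ x, ‖iteratedFDeriv ℝ 1 ψ x‖ = ‖D1 x‖ := fun x => by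
      rw [norm_iteratedFDeriv_one]
      rfl
    have hD2 : ∀ x, ‖iteratedFDeriv ℝ 2 ψ x‖ = ‖D2 x‖ := fun x => by
      rw [← norm_iteratedFDeriv_fderiv, norm_iteratedFDeriv_one]
      rfl
    have hbound : ∀ k x, ‖(Δ fun x => χ k x • ψ x) x‖
        ≤ n * (K * ‖D2 x‖ + 2 * K * ‖D1 x‖ + K * ‖ψ x‖) := by
      intro k x
      refine (norm_laplacian_le _ _).trans (mul_le_mul_of_nonneg_left ?_ (Nat.cast_nonneg n))
      refine (norm_iteratedFDeriv_smul_le (N := 2) (contDiff_infty.mp (hχs k) 2)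
        (contDiff_infty.mp hψ 2) x (n := 2) le_rfl).trans ?_
      rw [Finset.sum_range_succ, Finset.sum_range_succ, Finset.sum_range_one]
      simp only [Nat.choose_zero_right, Nat.choose_one_right, Nat.choose_self, Nat.cast_one, one_mul,
        Nat.sub_zero, Nat.cast_ofNat, norm_iteratedFDeriv_zero,
        hD0, hD1, hD2]
      have h0 := hχK k 0 (by norm_num) x
      rw [norm_iteratedFDeriv_zero] at h0
      have h1 := hχK k 1 (by norm_num) x
      have h2 := hχK k 2 le_rfl x
      gcongr
    have hlim1 : Tendsto (fun k => ∫ x, (Δ fun x => χ k x • ψ x) x * u x) atTop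
        (𝓝 (∫ x, (Δ ψ) x * u x)) := by
      refine tendsto_integral_of_dominated_convergence
        (fun x => (n * (K * ‖D2 x‖ + 2 * K * ‖D1 x‖ + K * ‖ψ x‖)) * ‖u x‖) (fun k => ?_) ?_
        (fun k => Eventually.of_forall fun x => ?_) (Eventually.of_forall fun x => ?_)
      · refine AEStronglyMeasurable.mul ?_ (Lp.aestronglyMeasurable u)
        have : ContDiff ℝ ∞ fun x => χ k x • ψ x := (hχs k).smul hψ
        let g : 𝓢(Eucl n, ℂ) := ((hχc k).smul_right (f' := ψ)).toSchwartzMap this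
        have e : (Δ fun x => χ k x • ψ x) = Δ g := by
          funext x
          rw [SchwartzMap.laplacian_apply]
          rfl
        rw [e]
        exact (Δ g).continuous.aestronglyMeasurable
      · have hm : MemLp (fun x => (n : ℝ) * (K * ‖D2 x‖ + 2 * K * ‖D1 x‖ + K * ‖ψ x‖)) 2 volume :=
          ((((D2.memLp 2).norm.const_mul K).add ((D1.memLp 2).norm.const_mul (2 * K))).add
            ((ψ.memLp 2).norm.const_mul K)).const_mul _
        exact hm.integrable_mul (Lp.memLp u).norm
      · rw [norm_mul]
        exact mul_le_mul_of_nonneg_right (hbound k x) (norm_nonneg _)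
      · refine tendsto_const_nhds.congr' ?_
        filter_upwards [hχ1 x] with k hk
        have e : (fun y => χ k y • ψ y) =ᶠ[𝓝 x] ψ := by
          filter_upwards [hk] with y hy
          rw [hy]
          simp
        rw [(InnerProductSpace.laplacian_congr_nhds e).eq_of_nhds, SchwartzMap.laplacian_apply]
    have hlim2 : Tendsto (fun k => ∫ x, χ k x • ψ x * f x) atTop (𝓝 (∫ x, ψ x * f x)) := by
      refine tendsto_integral_of_dominated_convergence
        (fun x => (K * ‖ψ x‖) * ‖f x‖) (fun k => ?_) ?_
        (fun k => Eventually.of_forall fun x => ?_) (Eventually.of_forall fun x => ?_)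
      · exact ((((hχs k).continuous).smul ψ.continuous).aestronglyMeasurable).mul
          (Lp.aestronglyMeasurable f)
      · exact ((ψ.memLp 2).norm.const_mul K).integrable_mul (Lp.memLp f).norm
      · rw [norm_mul, norm_smul]
        have h0 := hχK k 0 (by norm_num) x
        rw [norm_iteratedFDeriv_zero] at h0
        gcongr
      · refine tendsto_const_nhds.congr' ?_
        filter_upwards [hχ1 x] with k hk
        rw [hk.eq_of_nhds]
        simp
    refine tendsto_nhds_unique hlim1 ?_
    simp only [hk]
    exact hlim2.neg
  · intro h
    refine ⟨by simpa using locallyIntegrable_zero, fun φ h1 h2 => ?_⟩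
    have := h ((hasCompactSupport_ofReal_comp h2).toSchwartzMap (contDiff_ofReal_comp h1))
    simp only [SchwartzMap.laplacian_apply] at this
    simp only [zero_smul, smul_zero, integral_zero, add_zero, neg_smul, integral_neg,
      Complex.real_smul]
    rw [neg_eq_iff_eq_neg]
    refine Eq.trans ?_ this
    refine integral_congr_ae (Eventually.of_forall fun x => ?_)
    exact congrArg (· * u x) (laplacian_ofReal h1 x).symm

end WeakLaplacian

/-! ### The free group by Fourier transform, and the group of `-Δ + V`. -/

section FreeGroup

open SchwartzMap FourierTransform

variable {n : ℕ}

/-- The `L²` transform agrees with that of tempered distributions, which is defined by this duality.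
-/
theorem integral_fourier_mul_eq (ψ : 𝓢(Eucl n, ℂ)) (g : L2 n) :
    ∫ x, (𝓕 ψ) x * g x = ∫ x, ψ x * (𝓕 g : L2 n) x := by
  have h := congrArg (fun T : 𝓢'(Eucl n, ℂ) => T ψ) (Lp.fourier_toTemperedDistribution_eq g)
  simp only [TemperedDistribution.fourier_apply, Lp.toTemperedDistribution_apply, smul_eq_mul] at h
  exact h

theorem fourier_laplacian_apply (ψ : 𝓢(Eucl n, ℂ)) (ξ : Eucl n) :
    (𝓕 (Δ ψ)) ξ = -(((2 * Real.pi) ^ 2 * ‖ξ‖ ^ 2 : ℝ) : ℂ) * (𝓕 ψ) ξ := by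
  rw [SchwartzMap.laplacian_eq_fourierMultiplierCLM, SchwartzMap.fourierMultiplierCLM_apply,
    FourierTransform.fourier_smul, FourierTransform.fourier_fourierInv_eq, smul_apply,
    SchwartzMap.smulLeftCLM_apply_apply (by fun_prop)]
  simp only [Complex.real_smul]
  push_cast
  ring

/-- On the Fourier side `-Δ` is multiplication by `4π²|ξ|²`. -/
theorem weakSchrodinger_zero_iff_fourier (u f : L2 n) :
    WeakSchrodinger (fun _ => 0) u f ↔
      (𝓕⁻ f : L2 n) =ᵐ[volume]
        fun ξ => (((2 * Real.pi) ^ 2 * ‖ξ‖ ^ 2 : ℝ) : ℂ) * (𝓕⁻ u : L2 n) ξ := by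
  rw [weakSchrodinger_zero_iff_schwartz]
  set v : L2 n := 𝓕⁻ u
  set g : L2 n := 𝓕⁻ f
  have hu : u = 𝓕 v := (fourier_fourierInv_eq u).symm
  have hf : f = 𝓕 g := (fourier_fourierInv_eq f).symm
  have key : ∀ ψ : 𝓢(Eucl n, ℂ), (∫ x, (Δ ψ) x * u x = -∫ x, ψ x * f x) ↔
      ∫ ξ, (𝓕 ψ) ξ * ((((2 * Real.pi) ^ 2 * ‖ξ‖ ^ 2 : ℝ) : ℂ) * v ξ) = ∫ ξ, (𝓕 ψ) ξ * g ξ := by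
    intro ψ
    rw [hu, hf, ← integral_fourier_mul_eq, ← integral_fourier_mul_eq, ← neg_inj, neg_neg,
      ← integral_neg]
    simp only [fourier_laplacian_apply]
    refine Eq.congr (integral_congr_ae (Eventually.of_forall fun ξ => ?_)) rfl
    simp only
    ring
  simp only [key]
  constructor
  · intro h
    have hloc : LocallyIntegrable
        (fun ξ => (((2 * Real.pi) ^ 2 * ‖ξ‖ ^ 2 : ℝ) : ℂ) * v ξ) volume :=
      (locInt v).continuous_mul (by fun_prop)
    -- Every test function `η` is the Fourier transform of the Schwartz function `𝓕⁻ η`, so the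
    -- identity tests against all of them.
    have hz := ae_eq_zero_of_integral_contDiff_smul_eq_zero ((locInt g).sub hloc) fun φ h1 h2 => by
      let η : 𝓢(Eucl n, ℂ) :=
        (hasCompactSupport_ofReal_comp h2).toSchwartzMap (contDiff_ofReal_comp h1)
      have h3 := h (𝓕⁻ η)
      rw [fourier_fourierInv_eq] at h3
      simp only [Pi.sub_apply, smul_sub]
      rw [integral_sub (integrable_test h1.continuous h2 (locInt g))
        (integrable_test h1.continuous h2 hloc), sub_eq_zero]
      simp only [Complex.real_smul]
      exact h3.symm
    filter_upwards [hz] with ξ hξ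
    exact sub_eq_zero.1 hξ
  · intro h ψ
    refine integral_congr_ae ?_
    filter_upwards [h] with ξ hξ
    rw [hξ]

/-- The free Schrödinger group exists. -/
theorem exists_isUnitaryGroupOf_free (n : ℕ) :
    ∃ U : ℝ → (L2 n ≃ₗᵢ[ℂ] L2 n), IsUnitaryGroupOf (schrodingerOp fun _ : Eucl n => 0) U := by
  obtain ⟨M, hM0, hMadd, hMc, hMgen⟩ := exists_mul_group (μ := (volume : Measure (Eucl n)))
    (m := fun ξ => (2 * Real.pi) ^ 2 * ‖ξ‖ ^ 2) (by fun_prop)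
  let 𝓕L : L2 n ≃ₗᵢ[ℂ] L2 n := Lp.fourierTransformₗᵢ (Eucl n) ℂ
  have hinv : ∀ u : L2 n, 𝓕L.symm u = (𝓕⁻ u : L2 n) := fun u => rfl
  refine exists_isUnitaryGroupOf _
    (fun t => 𝓕L.toLinearIsometry.comp ((M t).comp 𝓕L.symm.toLinearIsometry))
    (fun u => ?_) (fun s t u => ?_) (fun u => ?_) (fun u w => ?_)
  · change 𝓕L (M 0 (𝓕L.symm u)) = u
    rw [hM0, LinearIsometryEquiv.apply_symm_apply]
  · change 𝓕L (M (s + t) (𝓕L.symm u)) = 𝓕L (M s (𝓕L.symm (𝓕L (M t (𝓕L.symm u)))))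
    rw [LinearIsometryEquiv.symm_apply_apply, hMadd]
  · exact 𝓕L.continuous.comp (hMc (𝓕L.symm u))
  · change HasDerivAt (fun t => 𝓕L (M t (𝓕L.symm u))) w 0 ↔ _
    have hd : HasDerivAt (fun t => 𝓕L (M t (𝓕L.symm u))) w 0 ↔
        HasDerivAt (fun t => M t (𝓕L.symm u)) (𝓕L.symm w) 0 := by
      constructor
      · intro h
        have := (𝓕L.symm.toContinuousLinearEquiv.toContinuousLinearMap.restrictScalars
          ℝ).hasFDerivAt.comp_hasDerivAt (0 : ℝ) h
        refine this.congr_of_eventuallyEq (Eventually.of_forall fun t => ?_)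
        exact (𝓕L.symm_apply_apply _).symm
      · intro h
        have := (𝓕L.toContinuousLinearEquiv.toContinuousLinearMap.restrictScalars
          ℝ).hasFDerivAt.comp_hasDerivAt (0 : ℝ) h
        refine this.congr_deriv ?_
        exact 𝓕L.apply_symm_apply w
    rw [hd, hMgen, mem_graph_schrodingerOp, weakSchrodinger_zero_iff_fourier, ← hinv, ← hinv,
      map_smul]
    have hs := Lp.coeFn_smul Complex.I (𝓕L.symm w)
    constructor
    · intro h
      filter_upwards [h, hs] with ξ h1 h2
      rw [h2, Pi.smul_apply, h1, smul_eq_mul, ← mul_assoc, mul_neg, ← mul_assoc, Complex.I_mul_I]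
      ring
    · intro h
      filter_upwards [h, hs] with ξ h1 h2
      rw [h2, Pi.smul_apply, smul_eq_mul] at h1
      rw [neg_mul, mul_assoc, ← h1, ← mul_assoc, Complex.I_mul_I]
      ring

/-- Since `V u` is itself in `L²`, it can be moved to the right-hand side; this reduces `-Δ + V` to
`-Δ` in the form that `exists_perturbation` needs. -/
theorem weakSchrodinger_iff_sub {V : Eucl n → ℝ} {B : L2 n →L[ℂ] L2 n}
    (hB : ∀ u : L2 n, B u =ᵐ[volume] fun x => (V x : ℂ) * u x) (u f : L2 n) :
    WeakSchrodinger V u f ↔ WeakSchrodinger (fun _ => 0) u (f - B u) := by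
  have hVu : LocallyIntegrable (fun x => V x • u x) volume :=
    (locInt (B u)).congr (by
      filter_upwards [hB u] with x hx
      rw [hx, Complex.real_smul])
  have e : ∀ φ : Eucl n → ℝ, ContDiff ℝ ∞ φ → HasCompactSupport φ →
      ∫ x, φ x • (f - B u : L2 n) x = (∫ x, φ x • f x) - ∫ x, φ x • (V x • u x) := by
    intro φ h1 h2
    rw [← integral_sub (integrable_test h1.continuous h2 (locInt f))
      (integrable_test h1.continuous h2 hVu)]
    refine integral_congr_ae ?_
    filter_upwards [Lp.coeFn_sub f (B u), hB u] with x h3 h4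
    rw [h3, Pi.sub_apply, h4, smul_sub, Complex.real_smul (x := V x)]
  refine ⟨fun h => ⟨by simpa using locallyIntegrable_zero, fun φ h1 h2 => ?_⟩,
    fun h => ⟨hVu, fun φ h1 h2 => ?_⟩⟩
  · rw [e φ h1 h2, ← h.2 φ h1 h2]
    simp
  · have := h.2 φ h1 h2
    rw [e φ h1 h2] at this
    simp only [zero_smul, smul_zero, integral_zero, add_zero] at this
    rw [this, sub_add_cancel]

/-- Multiplication by a bounded continuous potential. -/
theorem exists_mul_potential {V : Eucl n → ℝ} (hV : Continuous V) {C : ℝ} (hC : ∀ x, |V x| ≤ C) :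
    ∃ B : L2 n →L[ℂ] L2 n, ∀ u, B u =ᵐ[volume] fun x => (V x : ℂ) * u x :=
  exists_mul_clm (C := C) (Complex.continuous_ofReal.comp hV).aestronglyMeasurable
    (fun x => by simpa using hC x)

/-- For bounded continuous `V` the operator `-Δ + V` generates a unitary group. -/
theorem exists_isUnitaryGroupOf_schrodingerOp {V : Eucl n → ℝ} (hV : Continuous V) {C : ℝ}
    (hC : ∀ x, |V x| ≤ C) :
    ∃ U : ℝ → (L2 n ≃ₗᵢ[ℂ] L2 n), IsUnitaryGroupOf (schrodingerOp V) U := by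
  obtain ⟨U, hU⟩ := exists_isUnitaryGroupOf_free n
  obtain ⟨B, hB⟩ := exists_mul_potential hV hC
  refine hU.exists_perturbation B (fun u => ?_) (fun u f => ?_)
  · have e : inner ℂ u (B u) = ((∫ x, V x * ‖u x‖ ^ 2 : ℝ) : ℂ) := by
      rw [L2.inner_def, ← integral_complex_ofReal]
      refine integral_congr_ae ?_
      filter_upwards [hB u] with x hx
      rw [hx, ← smul_eq_mul, inner_smul_right, inner_self_eq_norm_sq_to_K]
      simp
    rw [e, Complex.ofReal_im]
  · rw [mem_graph_schrodingerOp, mem_graph_schrodingerOp, weakSchrodinger_iff_sub hB]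

/-- Rules out the default branch in the definition of `expNegI`. -/
theorem isUnitaryGroupOf_expNegI {H : Type*} [NormedAddCommGroup H] [InnerProductSpace ℂ H]
    {A : H →ₗ.[ℂ] H} (h : ∃ U : ℝ → (H ≃ₗᵢ[ℂ] H), IsUnitaryGroupOf A U) :
    IsUnitaryGroupOf A (expNegI A) := by
  unfold expNegI
  rw [dif_pos h]
  exact h.choose_spec

end FreeGroup

/-! ### Boundedness of the potential. -/

section Potential

variable {n : ℕ} {V Vinf Vs : Eucl n → ℝ}

/-- An asymptotically homogeneous potential is bounded. -/
theorem IsAsympHomogeneous.exists_bound (hV : IsAsympHomogeneous V Vinf Vs) :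
    ∃ C, ∀ x, |V x| ≤ C := by
  have h1 := hV.decay.bound (c := 1) one_pos
  rw [← comap_norm_atTop, eventually_comap] at h1
  obtain ⟨r, hr⟩ := eventually_atTop.1 h1
  set ρ : ℝ := max r 1
  have hρ : 1 ≤ ρ := le_max_right _ _
  have hs : ∀ x : Eucl n, ρ ≤ ‖x‖ → |Vs x| ≤ 1 := by
    intro x hx
    have := hr ‖x‖ ((le_max_left _ _).trans hx) x rfl
    rw [Real.norm_eq_abs, one_mul, norm_inv, norm_norm] at this
    exact this.trans (inv_le_one_of_one_le₀ (hρ.trans hx))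
  obtain ⟨C, hC⟩ := (isCompact_closedBall (0 : Eucl n) ρ).exists_bound_of_continuousOn
    hV.smooth.continuous.continuousOn
  refine ⟨C + 2, fun x => ?_⟩
  rcases le_total ‖x‖ ρ with hx | hx
  · have := hC x (by simpa using hx)
    rw [Real.norm_eq_abs] at this
    linarith
  · have hx0 : 0 < ‖x‖ := by linarith
    -- The radial projection of `x` to the sphere of radius `ρ`: `Vinf` takes the same value there,
    -- and `V` is bounded there by compactness.
    set y : Eucl n := (ρ * ‖x‖⁻¹) • x
    have hy : ‖y‖ = ρ := by
      rw [norm_smul, Real.norm_eq_abs, abs_of_pos (by positivity), mul_assoc,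
        inv_mul_cancel₀ hx0.ne', mul_one]
    have e : Vinf x = Vinf y := by
      rw [hV.homogeneous x (hρ.trans hx), hV.homogeneous y (by rw [hy]; exact hρ), hy, smul_smul,
        ← mul_assoc, inv_mul_cancel₀ (by linarith), one_mul]
    have e' : V x = V y - Vs y + Vs x := by
      rw [hV.decomp x, hV.decomp y, e]
      ring
    have h2 := hC y (by simp [hy])
    rw [Real.norm_eq_abs] at h2
    have h3 := hs y hy.ge
    have h4 := hs x hx
    rw [abs_le] at *
    constructor <;> linarith

end Potential

/-! ### Balls inside the shrinking cone. -/

section Cone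

open InnerProductGeometry

variable {n : ℕ} {V Vinf Vs : Eucl n → ℝ}

theorem coneExponent_nonneg (k : ℕ) : 0 ≤ coneExponent k := by
  unfold coneExponent
  split_ifs <;> positivity

/-- This makes the width `r * r ^ (-l)` of the cone unbounded as `r → ∞`. -/
theorem coneExponent_lt_one (k : ℕ) : coneExponent k < 1 := by
  unfold coneExponent
  split_ifs with h
  · norm_num
  · have : (1 : ℝ) ≤ k := by exact_mod_cast Nat.one_le_iff_ne_zero.2 h
    rw [div_lt_one (by positivity)]
    linarith

/-- The angle between unit vectors is at most `π / 2` times the length of the chord. -/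
theorem angle_le_norm_sub {x y : Eucl n} (hx : ‖x‖ = 1) (hy : ‖y‖ = 1) :
    angle x y ≤ Real.pi / 2 * ‖x - y‖ := by
  have h1 := norm_sub_sq_eq_norm_sq_add_norm_sq_sub_two_mul_norm_mul_norm_mul_cos_angle x y
  have ha := angle_nonneg x y
  have h2 := Real.cos_le_one_sub_mul_cos_sq (x := angle x y)
    (by rw [abs_of_nonneg ha]; exact angle_le_pi x y)
  rw [hx, hy] at h1
  have hπ := Real.pi_pos
  refine (sq_le_sq₀ ha (by positivity)).1 ?_
  have h3 : 4 / Real.pi ^ 2 * angle x y ^ 2 ≤ ‖x - y‖ ^ 2 := by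
    have : 4 / Real.pi ^ 2 * angle x y ^ 2 = 2 * (2 / Real.pi ^ 2 * angle x y ^ 2) := by ring
    rw [sq ‖x - y‖]
    linarith
  calc angle x y ^ 2 = Real.pi ^ 2 / 4 * (4 / Real.pi ^ 2 * angle x y ^ 2) := by
        field_simp
    _ ≤ Real.pi ^ 2 / 4 * ‖x - y‖ ^ 2 := mul_le_mul_of_nonneg_left h3 (by positivity)
    _ = _ := by ring

/-- After multiplication by `r` the error is the displacement `x - r • θ` plus a radial correction
of size `|r - ‖x‖|`, each at most `ρ`. -/
theorem norm_inv_smul_sub_le {x θ : Eucl n} (hθ : ‖θ‖ = 1) {r ρ : ℝ} (hr : 0 < r)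
    (hx : ‖x - r • θ‖ ≤ ρ) : ‖‖x‖⁻¹ • x - θ‖ ≤ 2 * ρ / r := by
  have hrθ : ‖r • θ‖ = r := by rw [norm_smul, hθ, mul_one, Real.norm_eq_abs, abs_of_pos hr]
  have h1 : |‖x‖ - r| ≤ ρ := by
    have := abs_norm_sub_norm_le x (r • θ)
    rw [hrθ] at this
    exact this.trans hx
  rw [le_div_iff₀ hr]
  have e : r • (‖x‖⁻¹ • x - θ) = (x - r • θ) + (r - ‖x‖) • (‖x‖⁻¹ • x) := by
    rcases eq_or_ne x 0 with rfl | h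
    · simp
    · have h0 : ‖x‖ * ‖x‖⁻¹ = 1 := mul_inv_cancel₀ (norm_ne_zero_iff.2 h)
      rw [sub_smul, smul_smul ‖x‖, h0]
      module
  have h2 : ‖‖x‖⁻¹ • x‖ ≤ 1 := by
    rw [norm_smul, norm_inv, norm_norm]
    exact inv_mul_le_one
  calc ‖‖x‖⁻¹ • x - θ‖ * r = ‖r • (‖x‖⁻¹ • x - θ)‖ := by
        rw [norm_smul, Real.norm_eq_abs, abs_of_pos hr, mul_comm]
    _ ≤ ρ + |r - ‖x‖| * 1 := by
        rw [e]
        refine (norm_add_le _ _).trans (add_le_add hx ?_)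
        rw [norm_smul, Real.norm_eq_abs]
        exact mul_le_mul_of_nonneg_left h2 (abs_nonneg _)
    _ ≤ 2 * ρ := by
        rw [abs_sub_comm]
        linarith

/-- A ball of a given radius, moved far out in the direction `θ₀`, is in the shrinking cone, and
the potential is nearly constant on it. -/
theorem IsAsympHomogeneous.exists_ball_subset_cone (hV : IsAsympHomogeneous V Vinf Vs)
    {θ₀ : Eucl n} (hθ₀ : ‖θ₀‖ = 1)
    (hcont : ContinuousAt (fun x => Vinf (‖x‖⁻¹ • x)) θ₀) (R : ℝ) {C l : ℝ} (hC : 0 < C)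
    (hl0 : 0 ≤ l) (hl1 : l < 1) {ρ δ : ℝ} (hρ : 0 < ρ) (hδ : 0 < δ) :
    ∃ r : ℝ, ∀ x, ‖x - r • θ₀‖ ≤ ρ → x ∈ shrinkingCone θ₀ R C l ∧ |V x - Vinf θ₀| ≤ δ := by
  have hdec := hV.decay.bound (c := δ / 2) (by positivity)
  rw [← comap_norm_atTop, eventually_comap] at hdec
  obtain ⟨r₁, hr₁⟩ := eventually_atTop.1 hdec
  obtain ⟨η, hη, hcη⟩ := Metric.continuousAt_iff.1 hcont (δ / 2) (by positivity)
  -- The angle on the ball is at most `π/2 * (2ρ/r)`, and `‖x‖ ≤ 2r` bounds the opening of the cone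
  -- below by `C * (2r) ^ (-l)`.
  have hcone : ∀ᶠ r : ℝ in atTop, Real.pi * ρ < C * 2 ^ (-l) * r ^ (1 - l) :=
    ((tendsto_rpow_atTop (sub_pos.2 hl1)).const_mul_atTop (by positivity)).eventually_gt_atTop _
  -- As `‖x‖ ≥ r - ρ`, the summands ensure in turn `1 ≤ ‖x‖ ≤ 2r`, `R < ‖x‖`, the decay of `Vs`, and
  -- a direction within `η` of `θ₀`.
  obtain ⟨r, hr, hr2⟩ := (hcone.and (eventually_ge_atTop
    (1 + 2 * ρ + |R| + |r₁| + 2 * ρ / η + 1))).exists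
  have hη' : 0 < 2 * ρ / η := by positivity
  have hR := abs_nonneg R
  have hr₁' := abs_nonneg r₁
  have hr0 : 0 < r := by linarith
  refine ⟨r, fun x hx => ?_⟩
  have hrθ : ‖r • θ₀‖ = r := by rw [norm_smul, hθ₀, mul_one, Real.norm_eq_abs, abs_of_pos hr0]
  have hnorm : |‖x‖ - r| ≤ ρ := by
    have := abs_norm_sub_norm_le x (r • θ₀)
    rw [hrθ] at this
    exact this.trans hx
  rw [abs_le] at hnorm
  have hx1 : 1 ≤ ‖x‖ := by linarith
  have hx0 : 0 < ‖x‖ := by linarith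
  have hunit : ‖‖x‖⁻¹ • x‖ = 1 := by
    rw [norm_smul, norm_inv, norm_norm, inv_mul_cancel₀ hx0.ne']
  have hdir := norm_inv_smul_sub_le hθ₀ hr0 hx
  refine ⟨⟨by linarith [le_abs_self R], ?_⟩, ?_⟩
  · have h1 : angle x θ₀ ≤ Real.pi / 2 * (2 * ρ / r) := by
      rw [← angle_smul_left_of_pos x θ₀ (inv_pos.2 hx0)]
      exact (angle_le_norm_sub hunit hθ₀).trans
        (mul_le_mul_of_nonneg_left hdir (by positivity))
    have h2 : (2 * r) ^ (-l) ≤ ‖x‖ ^ (-l) :=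
      Real.rpow_le_rpow_of_nonpos hx0 (by linarith) (by linarith)
    have h3 : Real.pi / 2 * (2 * ρ / r) < C * (2 * r) ^ (-l) := by
      have e : Real.pi / 2 * (2 * ρ / r) = Real.pi * ρ / r := by ring
      rw [e, div_lt_iff₀ hr0, Real.mul_rpow zero_le_two hr0.le]
      refine hr.trans_eq ?_
      rw [sub_eq_neg_add, Real.rpow_add hr0, Real.rpow_one]
      ring
    exact (h1.trans_lt h3).trans_le (mul_le_mul_of_nonneg_left h2 hC.le)
  · have h1 : |Vs x| ≤ δ / 2 := by
      have := hr₁ ‖x‖ (by linarith [le_abs_self r₁]) x rfl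
      rw [Real.norm_eq_abs, norm_inv, norm_norm] at this
      exact this.trans (mul_le_of_le_one_right (by positivity) (inv_le_one_of_one_le₀ hx1))
    have h2 : |Vinf x - Vinf θ₀| ≤ δ / 2 := by
      have hd : dist (‖x‖⁻¹ • x) θ₀ < η := by
        rw [dist_eq_norm]
        refine hdir.trans_lt ?_
        rw [div_lt_comm₀ hr0 hη]
        linarith
      have := hcη hd
      rw [hunit, hθ₀, inv_one, one_smul, one_smul, ← hV.homogeneous x hx1, Real.dist_eq] at this
      exact this.le
    have e : V x - Vinf θ₀ = (Vinf x - Vinf θ₀) + Vs x := by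
      rw [hV.decomp x]
      ring
    rw [e]
    exact (abs_add_le _ _).trans (by linarith)

end Cone

/-! ### Quasimodes and their observed mass. -/

section Quasimode

open SchwartzMap

variable {n : ℕ}

theorem norm_toLp_sq (f : 𝓢(Eucl n, ℂ)) :
    ‖(f.toLp 2 : L2 n)‖ ^ 2 = ∫ x, ‖f x‖ ^ 2 := by
  have h1 := inner_self_eq_norm_sq_to_K (𝕜 := ℂ) (f.toLp 2 : L2 n)
  rw [L2.inner_def] at h1
  have h2 : ∫ x, inner ℂ ((f.toLp 2 : L2 n) x) ((f.toLp 2 : L2 n) x)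
      = ((∫ x, ‖f x‖ ^ 2 : ℝ) : ℂ) := by
    rw [← integral_complex_ofReal]
    refine integral_congr_ae ?_
    filter_upwards [f.coeFn_toLp 2 volume] with x hx
    rw [hx, inner_self_eq_norm_sq_to_K]
    simp
  rw [h2] at h1
  exact Complex.ofReal_injective (by simpa using h1.symm)

theorem norm_toLp_sq_of_rescaling {f g : 𝓢(Eucl n, ℂ)} {a ρ : ℝ} {c : Eucl n} (hρ : 0 < ρ)
    (h : ∀ x, g x = a • f (ρ⁻¹ • (x - c))) :
    ‖(g.toLp 2 : L2 n)‖ ^ 2 = a ^ 2 * (ρ ^ n * ‖(f.toLp 2 : L2 n)‖ ^ 2) := by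
  rw [norm_toLp_sq, norm_toLp_sq]
  have e : ∀ x, ‖g x‖ ^ 2 = a ^ 2 * ‖f (ρ⁻¹ • (x - c))‖ ^ 2 := by
    intro x
    rw [h, norm_smul, mul_pow, Real.norm_eq_abs, sq_abs]
  simp only [e]
  rw [integral_const_mul, integral_sub_right_eq_self (fun x => ‖f (ρ⁻¹ • x)‖ ^ 2) c,
    Measure.integral_comp_inv_smul_of_nonneg _ (fun x => ‖f x‖ ^ 2) hρ.le]
  simp

theorem laplacian_rescaling {f : Eucl n → ℂ} (hf : ContDiff ℝ ∞ f) (a : ℝ) (c x : Eucl n) :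
    (Δ fun x => f (a • (x - c))) x = a ^ 2 • (Δ f) (a • (x - c)) := by
  simp only [InnerProductSpace.laplacian_eq_iteratedFDeriv_stdOrthonormalBasis]
  rw [Finset.smul_sum, iteratedFDeriv_comp_sub (f := fun z => f (a • z)),
    iteratedFDeriv_comp_const_smul a (contDiff_infty.mp hf 2)]
  rfl

theorem norm_toLp_laplacian_sq_of_rescaling {f g : 𝓢(Eucl n, ℂ)} {ρ : ℝ} {c : Eucl n} (hρ : 0 < ρ)
    (h : ∀ x, g x = f (ρ⁻¹ • (x - c))) :
    ‖((Δ g).toLp 2 : L2 n)‖ ^ 2 = ((ρ⁻¹) ^ 2) ^ 2 * (ρ ^ n * ‖((Δ f).toLp 2 : L2 n)‖ ^ 2) := by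
  refine norm_toLp_sq_of_rescaling (c := c) hρ fun x => ?_
  rw [SchwartzMap.laplacian_apply, SchwartzMap.laplacian_apply, funext h]
  exact laplacian_rescaling f.smooth' _ _ _

set_option maxHeartbeats 800000 in
/-- Normalized bump functions of width `ρ` around any centre, whose Laplacian has `L²` norm of order
`ρ⁻²`. -/
theorem exists_normalized_bump (n : ℕ) : ∃ K : ℝ, ∀ (ρ : ℝ) (c : Eucl n), 0 < ρ →
    ∃ ψ : 𝓢(Eucl n, ℂ), ‖(ψ.toLp 2 : L2 n)‖ = 1 ∧ (∀ x, ρ < ‖x - c‖ → ψ x = 0) ∧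
      ‖((Δ ψ).toLp 2 : L2 n)‖ ≤ K * (ρ⁻¹) ^ 2 := by
  let b : ContDiffBump (0 : Eucl n) := ⟨1 / 2, 1, one_half_pos, one_half_lt_one⟩
  have hbs := contDiff_ofReal_comp (φ := b) b.contDiff
  have hbc := hasCompactSupport_ofReal_comp b.hasCompactSupport
  let φ : 𝓢(Eucl n, ℂ) := hbc.toSchwartzMap hbs
  have hφ : ∀ x, φ x = (b x : ℂ) := fun x => rfl
  obtain ⟨β, hβd⟩ : ∃ β, β = ‖(φ.toLp 2 : L2 n)‖ := ⟨_, rfl⟩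
  obtain ⟨α, hαd⟩ : ∃ α, α = ‖((Δ φ).toLp 2 : L2 n)‖ := ⟨_, rfl⟩
  have hα : 0 ≤ α := hαd ▸ norm_nonneg _
  have hβ : 0 < β := by
    rw [hβd]
    refine lt_of_le_of_ne (norm_nonneg _) fun h0 => ?_
    have h1 : (φ.toLp 2 : L2 n) = 0 := norm_eq_zero.1 h0.symm
    have h2 : (φ : Eucl n → ℂ) =ᵐ[volume] fun _ => 0 := by
      filter_upwards [φ.coeFn_toLp 2 volume, Lp.coeFn_zero ℂ 2 (volume : Measure (Eucl n))]
        with x hx hx0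
      rw [← hx, h1, hx0]
      rfl
    have h3 := congrFun (Measure.eq_of_ae_eq h2 φ.continuous continuous_const) 0
    rw [hφ, b.one_of_mem_closedBall (by simp [b])] at h3
    simp at h3
  -- Rescaling multiplies both squared norms by `ρ ^ n`, which normalization cancels; only the
  -- factor `ρ⁻²` of the Laplacian remains.
  refine ⟨α / β, fun ρ c hρ => ?_⟩
  have hs : ContDiff ℝ ∞ fun x => φ (ρ⁻¹ • (x - c)) := by
    exact hbs.comp ((contDiff_const_smul _).comp (contDiff_id.sub contDiff_const))
  have hz : ∀ x, ρ < ‖x - c‖ → φ (ρ⁻¹ • (x - c)) = 0 := by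
    intro x hx
    rw [hφ, b.zero_of_le_dist, Complex.ofReal_zero]
    change 1 ≤ _
    rw [dist_zero_right, norm_smul, norm_inv, Real.norm_eq_abs, abs_of_pos hρ,
      le_inv_mul_iff₀ hρ]
    linarith
  have hc : HasCompactSupport fun x => φ (ρ⁻¹ • (x - c)) :=
    HasCompactSupport.intro (isCompact_closedBall c ρ) fun x hx => hz x (by
      simpa [dist_eq_norm] using hx)
  let g : 𝓢(Eucl n, ℂ) := hc.toSchwartzMap hs
  have hg : ∀ x, g x = φ (ρ⁻¹ • (x - c)) := fun x => rfl
  obtain ⟨N, hNd⟩ : ∃ N, N = ‖(g.toLp 2 : L2 n)‖ := ⟨_, rfl⟩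
  have hN : N ^ 2 = ρ ^ n * β ^ 2 := by
    have := norm_toLp_sq_of_rescaling (a := 1) hρ (fun x => by rw [hg, one_smul])
    rwa [one_pow, one_mul, ← hNd, ← hβd] at this
  have hN0 : 0 < N := by
    refine lt_of_le_of_ne (hNd ▸ norm_nonneg _) fun h0 => ?_
    rw [← h0] at hN
    have : 0 < ρ ^ n * β ^ 2 := by positivity
    rw [← hN] at this
    simp at this
  have hD : ‖((Δ g).toLp 2 : L2 n)‖ = (ρ⁻¹) ^ 2 * (α / β * N) := by
    have hsq := norm_toLp_laplacian_sq_of_rescaling hρ hg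
    refine (sq_eq_sq₀ (norm_nonneg _) (by positivity)).1 (hsq.trans ?_)
    rw [← hαd, mul_pow, mul_pow (α / β), hN, div_pow, mul_left_comm (α ^ 2 / β ^ 2),
      div_mul_cancel₀ _ (pow_pos hβ 2).ne']
  have hsm : ∀ f : 𝓢(Eucl n, ℂ), ((((N⁻¹ : ℝ) : ℂ) • f).toLp 2 : L2 n)
      = ((N⁻¹ : ℝ) : ℂ) • (f.toLp 2 : L2 n) := fun f =>
    (SchwartzMap.toLpCLM ℂ ℂ 2 volume).map_smul _ f
  have hn : ‖((N⁻¹ : ℝ) : ℂ)‖ = N⁻¹ := by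
    rw [Complex.norm_real, Real.norm_eq_abs, abs_of_pos (inv_pos.2 hN0)]
  refine ⟨((N⁻¹ : ℝ) : ℂ) • g, ?_, fun x hx => ?_, ?_⟩
  · rw [hsm, norm_smul, hn, ← hNd, inv_mul_cancel₀ hN0.ne']
  · rw [smul_apply, hg, hz x hx, smul_zero]
  · have e : Δ (((N⁻¹ : ℝ) : ℂ) • g) = ((N⁻¹ : ℝ) : ℂ) • Δ g := by
      rw [← SchwartzMap.laplacianCLM_eq ℂ, map_smul, SchwartzMap.laplacianCLM_eq]
    rw [e, hsm, norm_smul, hn, hD]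
    refine le_of_eq ?_
    field_simp

/-- Quasimodes in the domain of `-Δ + V`, concentrated where `V` is nearly constant. -/
theorem mem_graph_and_norm_sub_smul_le {V : Eucl n → ℝ} (hV : Continuous V) {C : ℝ}
    (hC : ∀ x, |V x| ≤ C) (ψ : 𝓢(Eucl n, ℂ)) {v₀ δ : ℝ}
    (hψ : ∀ x, ψ x ≠ 0 → |V x - v₀| ≤ δ) :
    ∃ f : L2 n, ((ψ.toLp 2 : L2 n), f) ∈ (schrodingerOp V).graph ∧
      ‖f - (v₀ : ℂ) • (ψ.toLp 2 : L2 n)‖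
        ≤ ‖((Δ ψ).toLp 2 : L2 n)‖ + δ * ‖(ψ.toLp 2 : L2 n)‖ := by
  obtain ⟨B, hB⟩ := exists_mul_potential hV hC
  set u : L2 n := ψ.toLp 2
  set d : L2 n := (Δ ψ).toLp 2
  refine ⟨-d + B u, ?_, ?_⟩
  · rw [mem_graph_schrodingerOp, weakSchrodinger_iff_sub hB, add_sub_cancel_right,
      weakSchrodinger_zero_iff_schwartz]
    intro η
    have e1 : ∫ x, (Δ η) x * u x = ∫ x, (Δ η) x * ψ x := by
      refine integral_congr_ae ?_
      filter_upwards [ψ.coeFn_toLp 2 volume] with x hx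
      rw [hx]
    have e2 : ∫ x, η x * (-d : L2 n) x = -∫ x, η x * (Δ ψ) x := by
      rw [← integral_neg]
      refine integral_congr_ae ?_
      filter_upwards [(Δ ψ).coeFn_toLp 2 volume, Lp.coeFn_neg d] with x hx hx'
      rw [hx', Pi.neg_apply, hx, mul_neg]
    rw [e1, e2, neg_neg, SchwartzMap.integral_mul_laplacian_right_eq_left]
  · have hb : ‖B u - (v₀ : ℂ) • u‖ ≤ δ * ‖u‖ := by
      refine Lp.norm_le_mul_norm_of_ae_le_mul ?_
      filter_upwards [hB u, Lp.coeFn_sub (B u) ((v₀ : ℂ) • u), Lp.coeFn_smul (v₀ : ℂ) u,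
        ψ.coeFn_toLp 2 volume] with x h1 h2 h3 h4
      rw [h2, Pi.sub_apply, h1, h3, Pi.smul_apply, smul_eq_mul, ← sub_mul, norm_mul,
        ← Complex.ofReal_sub, Complex.norm_real, Real.norm_eq_abs]
      by_cases h0 : ψ x = 0
      · rw [h4, h0]
        simp
      · exact mul_le_mul_of_nonneg_right (hψ x h0) (norm_nonneg _)
    rw [add_sub_assoc]
    refine (norm_add_le _ _).trans ?_
    rw [norm_neg]
    linarith

theorem lintegral_enorm_sq_eq (f : L2 n) : ∫⁻ x, ‖f x‖ₑ ^ 2 = ‖f‖ₑ ^ 2 := by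
  rw [Lp.enorm_def]
  have := eLpNorm_nnreal_pow_eq_lintegral (μ := volume) (f := (f : Eucl n → ℂ)) (p := 2)
    two_ne_zero
  simpa using this.symm

/-- The observed mass of a quasimode that vanishes on the observation region. -/
theorem observedMass_le {V : Eucl n → ℝ} {Ω : Set (Eucl n)} (hΩ : MeasurableSet Ω)
    (hU : IsUnitaryGroupOf (schrodingerOp V) (expNegI (schrodingerOp V))) {u f : L2 n}
    (huf : (u, f) ∈ (schrodingerOp V).graph) (hu : ∀ᵐ x, x ∈ Ω → u x = 0) {v₀ ε T : ℝ}
    (hT : 0 ≤ T) (hf : ‖f - (v₀ : ℂ) • u‖ ≤ ε) :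
    observedMass V Ω T u ≤ ENNReal.ofReal ((T * ε) ^ 2 * T) := by
  have hε : 0 ≤ ε := (norm_nonneg _).trans hf
  have hslice : ∀ t ∈ Ioc 0 T, ∫⁻ x in Ω, ‖expNegI (schrodingerOp V) t u x‖ₑ ^ 2
      ≤ ENNReal.ofReal ((T * ε) ^ 2) := by
    intro t ht
    set z : ℂ := Complex.exp (-(Complex.I * (v₀ * t)))
    set w : L2 n := expNegI (schrodingerOp V) t u - z • u
    have hw : ‖w‖ ≤ T * ε :=
      (hU.norm_sub_exp_smul_le huf v₀ t ht.1.le).trans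
        (mul_le_mul ht.2 hf (norm_nonneg _) hT)
    -- On `Ω` the subtracted multiple of `u` vanishes, so only the Duhamel error is seen.
    have e : ∫⁻ x in Ω, ‖expNegI (schrodingerOp V) t u x‖ₑ ^ 2 = ∫⁻ x in Ω, ‖w x‖ₑ ^ 2 := by
      refine lintegral_congr_ae ?_
      rw [EventuallyEq, ae_restrict_iff' hΩ]
      filter_upwards [hu, Lp.coeFn_sub (expNegI (schrodingerOp V) t u) (z • u),
        Lp.coeFn_smul z u] with x h1 h2 h3 hx
      rw [h2, Pi.sub_apply, h3, Pi.smul_apply, h1 hx, smul_zero, sub_zero]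
    calc ∫⁻ x in Ω, ‖expNegI (schrodingerOp V) t u x‖ₑ ^ 2
        ≤ ∫⁻ x, ‖w x‖ₑ ^ 2 := e.trans_le (setLIntegral_le_lintegral _ _)
      _ = ENNReal.ofReal (‖w‖ ^ 2) := by
          rw [lintegral_enorm_sq_eq, ENNReal.ofReal_pow (norm_nonneg _), ofReal_norm]
      _ ≤ _ := ENNReal.ofReal_le_ofReal (by gcongr)
  calc observedMass V Ω T u
      ≤ ∫⁻ _ in Ioc 0 T, ENNReal.ofReal ((T * ε) ^ 2) :=
        setLIntegral_mono' measurableSet_Ioc hslice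
    _ = _ := by
        rw [setLIntegral_const, Real.volume_Ioc, sub_zero, ENNReal.ofReal_mul (by positivity)]

end Quasimode

/-! ### Failure of observability. -/

/-- Normalized data of arbitrarily small observed mass, if the observation region misses a
shrinking cone around a direction at which `V∞` is continuous. -/
theorem exists_norm_eq_one_observedMass_le {n : ℕ} {V Vinf Vs : Eucl n → ℝ}
    (hV : IsAsympHomogeneous V Vinf Vs) {θ₀ : Eucl n} (hθ₀ : ‖θ₀‖ = 1)
    (hcont : ContinuousAt (fun x => Vinf (‖x‖⁻¹ • x)) θ₀) {Ω : Set (Eucl n)}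
    (hΩm : MeasurableSet Ω) {R C l : ℝ} (hC : 0 < C) (hl0 : 0 ≤ l) (hl1 : l < 1)
    (hΩ : Ω ∩ {x | R < ‖x‖} ⊆ (shrinkingCone θ₀ R C l)ᶜ) {T ε : ℝ} (hT : 0 ≤ T) (hε : 0 < ε) :
    ∃ u : L2 n, ‖u‖ = 1 ∧ observedMass V Ω T u ≤ ENNReal.ofReal ((T * ε) ^ 2 * T) := by
  obtain ⟨M, hM⟩ := hV.exists_bound
  have hVc := hV.smooth.continuous
  have hU := isUnitaryGroupOf_expNegI (exists_isUnitaryGroupOf_schrodingerOp hVc hM)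
  obtain ⟨K, hbump⟩ := exists_normalized_bump n
  -- The error `ε` is shared: the width `ρ` makes the kinetic part at most `ε / 2`, then the
  -- distance `r`, depending on `ρ`, does the same for the potential.
  obtain ⟨ρ, hρ, hρK⟩ : ∃ ρ : ℝ, 0 < ρ ∧ K * (ρ⁻¹) ^ 2 ≤ ε / 2 := by
    have h1 : Tendsto (fun ρ : ℝ => K * (ρ⁻¹) ^ 2) atTop (𝓝 (K * 0 ^ 2)) :=
      (tendsto_inv_atTop_zero.pow 2).const_mul K
    have h2 : K * 0 ^ 2 < ε / 2 := by
      rw [zero_pow two_ne_zero, mul_zero]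
      positivity
    obtain ⟨ρ, h3, h4⟩ := ((h1.eventually_lt_const h2).and (eventually_gt_atTop 0)).exists
    exact ⟨ρ, h4, h3.le⟩
  obtain ⟨r, hr⟩ := hV.exists_ball_subset_cone hθ₀ hcont R hC hl0 hl1 hρ (half_pos hε)
  obtain ⟨ψ, hψ1, hψ0, hψΔ⟩ := hbump ρ (r • θ₀) hρ
  have hsupp : ∀ x, ψ x ≠ 0 → ‖x - r • θ₀‖ ≤ ρ := fun x hx =>
    not_lt.1 fun h => hx (hψ0 x h)
  obtain ⟨f, hf, hfn⟩ := mem_graph_and_norm_sub_smul_le hVc hM ψ (v₀ := Vinf θ₀) fun x hx =>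
    (hr x (hsupp x hx)).2
  have hzero : ∀ᵐ x, x ∈ Ω → (ψ.toLp 2 : L2 n) x = 0 := by
    filter_upwards [ψ.coeFn_toLp 2 volume] with x hx hxΩ
    rw [hx]
    by_contra h0
    have hcone := (hr x (hsupp x h0)).1
    exact hΩ ⟨hxΩ, hcone.1⟩ hcone
  rw [hψ1, mul_one] at hfn
  generalize (ψ.toLp 2 : L2 n) = u at hψ1 hf hfn hzero
  exact ⟨u, hψ1, observedMass_le hΩm hU hf hzero hT (hfn.trans (by linarith))⟩

end HomogeneousSchrodinger

end

theorem theorem1p4 {n : ℕ} (V Vinf Vs : HomogeneousSchrodinger.Eucl n → ℝ)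
    (hV : HomogeneousSchrodinger.IsAsympHomogeneous V Vinf Vs)
    (θ₀ : HomogeneousSchrodinger.Eucl n) (hθ₀ : ‖θ₀‖ = 1)
    (k : ℕ) (hk : HomogeneousSchrodinger.AngularDerivVanish Vinf θ₀ k)
    (Ω : Set (HomogeneousSchrodinger.Eucl n)) (hΩ_open : IsOpen Ω) (hΩ_conn : IsConnected Ω)
    (R C : ℝ) (hR : 0 < R) (hC : 0 < C)
    (hΩ : Ω ∩ {x | R < ‖x‖} ⊆
      (HomogeneousSchrodinger.shrinkingCone θ₀ R C
        (HomogeneousSchrodinger.coneExponent k))ᶜ)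
    (T : ℝ) (hT : 0 < T) :
    ¬ HomogeneousSchrodinger.Observable V Ω T ∧
      ∃ u : ℕ → HomogeneousSchrodinger.L2 n,
        (∀ m, ‖u m‖ = 1) ∧
        Tendsto (fun m => HomogeneousSchrodinger.observedMass V Ω T (u m)) atTop (𝓝 0) := by
  have hex := fun m : ℕ => HomogeneousSchrodinger.exists_norm_eq_one_observedMass_le hV hθ₀
    hk.1.continuousAt hΩ_open.measurableSet hC (HomogeneousSchrodinger.coneExponent_nonneg k)
    (HomogeneousSchrodinger.coneExponent_lt_one k) hΩ hT.le (ε := 1 / ((m : ℝ) + 1))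
    (by positivity)
  choose u hu1 hu using hex
  have hlim : Tendsto (fun m => HomogeneousSchrodinger.observedMass V Ω T (u m)) atTop (𝓝 0) := by
    have h1 : Tendsto (fun m : ℕ => (T * (1 / ((m : ℝ) + 1))) ^ 2 * T) atTop
        (𝓝 ((T * 0) ^ 2 * T)) :=
      ((tendsto_one_div_add_atTop_nhds_zero_nat.const_mul T).pow 2).mul_const T
    have h2 := ENNReal.tendsto_ofReal h1
    rw [mul_zero, zero_pow two_ne_zero, zero_mul, ENNReal.ofReal_zero] at h2
    exact tendsto_of_tendsto_of_tendsto_of_le_of_le tendsto_const_nhds h2 (fun _ => zero_le) hu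
  refine ⟨?_, u, hu1, hlim⟩
  rintro ⟨C', -, hobs⟩
  have h1 : ∀ m, 1 ≤ ENNReal.ofReal C' * HomogeneousSchrodinger.observedMass V Ω T (u m) := by
    intro m
    have := hobs (u m)
    rwa [← ofReal_norm, hu1, ENNReal.ofReal_one, one_pow] at this
  have h2 := ENNReal.Tendsto.const_mul (a := ENNReal.ofReal C') hlim
    (Or.inr ENNReal.ofReal_ne_top)
  rw [mul_zero] at h2
  exact not_le.2 one_pos (ge_of_tendsto' h2 h1)
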